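/- Let $n\ge 3$. Let $\Gamma_n=\langle b_1,\dots,b_n \mid b_1^2=\dots=b_n^2=1\rangle$, and let $\Delta$ be its Cayley graph, an $n$-regular tree with vertex set $V(\Delta)=\Gamma_n$ in which $g$ and $gb_i$ are joined by an edge of colour $i$. For $v\in V(\Delta)$ and $I\subset\{1,\dots,n\}$ let $[v;I]$ be the connected component containing $v$ of the graph obtained from $\Delta$ by deleting all edges whose colour is not in $I$. Let $\mathcal X$ be the set of all such subtrees with $|I|=n-1$, and $\mathcal A$ the set of all such subtrees with $|I|=2$ (the alternating geodesics). For $v\in V(\Delta)$ write $X_i(v)=[v;\{1,\dots,n\}\setminus\{i\}]\in\mathcal X$. A Hurwitz map is a function $\phi:\mathcal X\to\mathbb C$ with $$\phi(X_i(v))+\phi(X_i(vb_i))=\prod_{j\ne i}\phi(X_j(v))\qquad\text{for all } v\in V(\Delta),\ 1\le i\le n.$$ It is extended to $\mathcal A$ and to $V(\Delta)$ by $$\phi([v;\{i,j\}])=\prod_{k\neq i,j}\phi(X_k(v)),\qquad \phi(v)=\prod_{k=1}^n\phi(X_k(v)).$$ For $\mu\in\mathbb C$, let $\mathcal B_\mu$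 be the set of Hurwitz maps $\phi$ such that $\sum_{i}\phi(X_i(v))^2-\prod_i\phi(X_i(v))=\mu$ for every $v\in V(\Delta)$, such that $\phi(\gamma)\notin[-2,2]$ for every $\gamma\in\mathcal A$, and such that $\{\gamma\in\mathcal A : |\phi(\gamma)|\le K\}$ is finite for some $K>2$. **Theorem.** Let $\mu\in\mathbb C$ and $\phi\in\mathcal B_\mu$. Then $$\sum_{\gamma\in\mathcal A}h(\phi(\gamma))-\sum_{v\in V(\Delta)}\frac{\mu}{\phi(v)}=1,\qquad h(z)=1-\sqrt{1-\frac{4}{z^2}},$$ where the square root is the one with non-negative real part and both infinite sums converge absolutely. In particular, when $\mu=0$, $$\sum_{\gamma\in\mathcal A}\left(1-\sqrt{1-\frac{4}{\phi(\gamma)^2}}\right)=1 .$$ -/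

import Mathlib

namespace MarkoffHurwitz

noncomputable section

/-! ### The group and its Cayley tree -/

/-- The relators `b_i ^ 2` of `Γ_n`. -/
def gammaRels (n : ℕ) : Set (FreeGroup (Fin n)) :=
  Set.range fun i : Fin n => FreeGroup.of i ^ 2

/-- `Γ_n = ⟨ b_1, …, b_n ∣ b_1 ^ 2 = ⋯ = b_n ^ 2 = 1 ⟩`. -/
abbrev Gamma (n : ℕ) : Type := PresentedGroup (gammaRels n)

/-- The generator `b_i` of `Γ_n`. -/
def gen {n : ℕ} (i : Fin n) : Gamma n := PresentedGroup.of i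

theorem gen_mul_gen {n : ℕ} (i : Fin n) : gen i * gen i = 1 := by
  have h : PresentedGroup.mk (gammaRels n) (FreeGroup.of i ^ 2) = 1 :=
    PresentedGroup.one_of_mem (Set.mem_range_self i)
  rw [map_pow, pow_two] at h
  exact h

theorem gen_ne_one {n : ℕ} (i : Fin n) : gen i ≠ 1 := by
  intro h
  have hr : ∀ r ∈ gammaRels n,
      FreeGroup.lift (fun _ : Fin n => Multiplicative.ofAdd (1 : ZMod 2)) r = 1 := by
    rintro r ⟨j, rfl⟩
    simp only [map_pow, FreeGroup.lift_apply_of]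
    decide
  have h2 := congrArg (PresentedGroup.toGroup hr) h
  have h3 := (PresentedGroup.toGroup.of hr).symm.trans (h2.trans (map_one _))
  exact absurd h3 (by decide)

/-- The graph with vertex set `V(Δ) = Γ_n` and with those edges of the Cayley graph `Δ` of `Γ_n`
whose colour lies in `I`, the `i`-edges being those between `g` and `g * b_i`.  It is the graph
obtained from `Δ` by deleting all the edges whose colour lies in the complement of `I`; for
`I = univ` it is the Cayley tree `Δ` itself. -/
def colourGraph (n : ℕ) (I : Finset (Fin n)) : SimpleGraph (Gamma n) where
  Adj g h := ∃ i ∈ I, h = g * gen i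
  symm := ⟨by
    rintro g h ⟨i, hi, rfl⟩
    exact ⟨i, hi, by rw [mul_assoc, gen_mul_gen, mul_one]⟩⟩
  loopless := ⟨by
    rintro g ⟨i, -, h⟩
    exact gen_ne_one i (mul_eq_left.mp h.symm)⟩

/-! ### Regular subtrees -/

/-- `T^{|k|}(Δ)`: the regularly labelled `k`-subtrees of `Δ`.  Such a subtree is given by a set `I`
of `k` colours and a connected component of `Δ` minus the edges with colour outside `I`. -/
def RegSubtree (n k : ℕ) : Type :=
  Σ I : {I : Finset (Fin n) // I.card = k}, (colourGraph n I.1).ConnectedComponent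

/-- `[v; I]`, the regular subtree with colour set `I` through the vertex `v`. -/
def regSubtree {n k : ℕ} (v : Gamma n) (I : Finset (Fin n)) (hI : I.card = k) : RegSubtree n k :=
  ⟨⟨I, hI⟩, (colourGraph n I).connectedComponentMk v⟩

/-- `𝒳 = T^{|n-1|}(Δ)`. -/
abbrev X (n : ℕ) : Type := RegSubtree n (n - 1)

/-- `𝒜 = T^{|2|}(Δ)`, the set of alternating geodesics of `Δ`. -/
abbrev A (n : ℕ) : Type := RegSubtree n 2

/-- `X_i = [v; [n] \ {i}]`, the element of `𝒳` through `v` that misses the colour `i`. -/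
def hatSubtree {n : ℕ} (v : Gamma n) (i : Fin n) : X n :=
  regSubtree v {i}ᶜ (by rw [Finset.card_compl, Finset.card_singleton, Fintype.card_fin])

theorem hatSubtree_mul_gen {n : ℕ} (v : Gamma n) {i j : Fin n} (hij : j ≠ i) :
    hatSubtree (v * gen j) i = hatSubtree v i := by
  have h : (colourGraph n {i}ᶜ).connectedComponentMk (v * gen j) =
      (colourGraph n {i}ᶜ).connectedComponentMk v := by
    refine (SimpleGraph.ConnectedComponent.eq.mpr (SimpleGraph.Adj.reachable ?_)).symm
    exact ⟨j, by simpa using hij, rfl⟩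
  exact congrArg (Sigma.mk (β := fun I : {I : Finset (Fin n) // I.card = n - 1} =>
    (colourGraph n I.1).ConnectedComponent) _) h

theorem hatSubtree_eq_of_walk {n : ℕ} {I : Finset (Fin n)} {v w : Gamma n}
    (p : (colourGraph n I).Walk v w) {i : Fin n} (hi : i ∉ I) :
    hatSubtree v i = hatSubtree w i := by
  induction p with
  | nil => rfl
  | cons h _ ih =>
    obtain ⟨j, hj, rfl⟩ := h
    rw [← ih, hatSubtree_mul_gen]
    rintro rfl
    exact hi hj

/-! ### Hurwitz maps -/

/-- A Hurwitz map `φ : 𝒳 → ℂ`: for every `i`-edge, with end points `v` and `v' = v * b_i`,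
`φ(X_i) + φ(X_i') = ∏_{j ≠ i} φ(X_j)`. -/
def IsHurwitzMap {n : ℕ} (φ : X n → ℂ) : Prop :=
  ∀ (v : Gamma n) (i : Fin n),
    φ (hatSubtree v i) + φ (hatSubtree (v * gen i) i) =
      ∏ j ∈ Finset.univ.erase i, φ (hatSubtree v j)

/-- A `μ`-Hurwitz map: a Hurwitz map that satisfies the vertex relation
`x_1 ^ 2 + ⋯ + x_n ^ 2 - x_1 ⋯ x_n = μ` at every vertex. -/
def IsMuHurwitzMap {n : ℕ} (μ : ℂ) (φ : X n → ℂ) : Prop :=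
  IsHurwitzMap φ ∧
    ∀ v : Gamma n, ∑ i, φ (hatSubtree v i) ^ 2 - ∏ i, φ (hatSubtree v i) = μ

/-- The extension of `φ : 𝒳 → ℂ` to the regular subtrees of `Δ`:
`φ([v; I]) = ∏_{i ∉ I} φ(X_i)`, where `X_i = [v; [n] \ {i}]`. -/
def extend {n k : ℕ} (φ : X n → ℂ) (T : RegSubtree n k) : ℂ :=
  T.2.lift (fun v => ∏ i ∈ T.1.1ᶜ, φ (hatSubtree v i)) (by
    intro v w p _
    refine Finset.prod_congr rfl fun i hi => ?_
    rw [hatSubtree_eq_of_walk p (Finset.mem_compl.mp hi)])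

/-- The extension of `φ` to the vertices, `V(Δ) = T^{|0|}(Δ)`: `φ(v) = ∏_i φ(X_i)`. -/
def vertexValue {n : ℕ} (φ : X n → ℂ) (v : Gamma n) : ℂ :=
  extend φ (regSubtree v ∅ Finset.card_empty)

/-! ### The Bowditch conditions -/

/-- `𝒜_φ(K)`. -/
def smallGeodesics {n : ℕ} (φ : X n → ℂ) (K : ℝ) : Set (A n) :=
  {γ | ‖extend φ γ‖ ≤ K}

/-- The Bowditch set `ℬ`: Hurwitz maps with `φ(γ) ∉ [-2, 2]` for all `γ ∈ 𝒜` and with `𝒜_φ(K)`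
finite for some `K > 2`. -/
def bowditchSet (n : ℕ) : Set (X n → ℂ) :=
  {φ | IsHurwitzMap φ ∧
    (∀ γ : A n, extend φ γ ∉ ((↑) : ℝ → ℂ) '' Set.Icc (-2) 2) ∧
    ∃ K : ℝ, 2 < K ∧ (smallGeodesics φ K).Finite}

/-- `ℬ_μ`, the set of `μ`-Hurwitz maps in `ℬ`. -/
def bowditchSetMu (n : ℕ) (μ : ℂ) : Set (X n → ℂ) :=
  {φ | φ ∈ bowditchSet n ∧ IsMuHurwitzMap μ φ}

/-- `h(z) = 1 - √(1 - 4 / z ^ 2)`, where the square root has non-negative real part. -/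
def h (z : ℂ) : ℂ := 1 - Complex.sqrt (1 - 4 / z ^ 2)

end

end MarkoffHurwitz

namespace MarkoffHurwitz

noncomputable section

open Filter Topology

/-! ### Reduced words -/

/-! Root the tree at `1`. Vertices become reduced words, and the edges pointing away from the root
are `w → i :: w`. Write `x_j` for the values at `w`, `x_i'` for the new value at `i :: w`, `P = ∏_{j
≠ i} x_j`, `z_j` for the value of the geodesic with colours `i, j` through the edge, and `η = h /
2`. Attach to the edge the numbers `r = x_i / P` (`edgeRatio`) and `s = ∑_{j ≠ i} η(z_j)`
(`edgeEta`). By the edge relation the ratios of the two directions of an edge add up to `1`; by the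
vertex relation the ratios at `v` add up to `1 + μ / φ(v)`. Hence the sum of `r` over the edges
leaving level `m` is `1 + ∑ μ / φ(v)` over the levels `≤ m` (`edgeSum_edgeRatio`). A geodesic whose
vertex nearest to the root (its gate) has level `≤ m` crosses to level `m + 1` exactly twice, so the
sum of `s` is `∑ h(φ(γ))` over these geodesics (`edgeSum_edgeEta`). It remains to show that the sum
of `r - s` over a level tends to `0`.

Since `r(1 - r) = ∑ 1 / z_j² - μ / P²` and `η(1 - η) = 1 / z²`, the product `(r - s)(1 - r - s)`
equals `∑_{j ≠ k} η(z_j) η(z_k) - μ / P²` (`sub_mul_one_sub_sub`). Far from the root the second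
factor is bounded below, and the right side is at most a constant times `E = ∑_{j ≠ k} a_j a_k`,
where `a_j` is `2 / |z_j|` if `|z_j| > K` and a constant `τ < 1` otherwise. A newborn geodesic has
weight at most the product of two old ones, so the values of `E` on the successors of an edge sum to
at most `ρ E` with `ρ < 1` (`exists_sum_edgeWeight_le`). The resulting geometric decay gives both
the summability and the limit (`identity`).

Submultiplicativity rests on two facts far from the root. Every edge is `Good`, because along a
chain of bad edges the vertex product shrinks geometrically, yet it is bounded below
(`exists_forall_good`). And along each of the finitely many small geodesics the values obey `y_{m+2}
= z y_{m+1} - y_m`, where `z ∉ [-2, 2]` forces exponential growth with a ratio that stays away from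
`η(z)` (`exists_expanding`). -/

/-- The colours that extend the word `w` (whose top letter is its head) to a reduced word. -/
def freeColours {n : ℕ} (w : List (Fin n)) : Finset (Fin n) :=
  Finset.univ.filter fun i => w.head? ≠ some i

theorem mem_freeColours {n : ℕ} {w : List (Fin n)} {i : Fin n} :
    i ∈ freeColours w ↔ w.head? ≠ some i := by
  simp [freeColours]

@[simp] theorem freeColours_nil {n : ℕ} : freeColours ([] : List (Fin n)) = Finset.univ := by
  ext i; simp [mem_freeColours]

@[simp] theorem freeColours_cons {n : ℕ} (i : Fin n) (w : List (Fin n)) :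
    freeColours (i :: w) = Finset.univ.erase i := by
  ext j; simp [mem_freeColours, eq_comm]

/-- Words without two equal neighbouring letters. -/
def IsReduced {n : ℕ} (w : List (Fin n)) : Prop := w.IsChain (· ≠ ·)

theorem isReduced_nil {n : ℕ} : IsReduced ([] : List (Fin n)) := List.isChain_nil

theorem isReduced_cons {n : ℕ} {i : Fin n} {w : List (Fin n)} :
    IsReduced (i :: w) ↔ i ∈ freeColours w ∧ IsReduced w := by
  cases w with
  | nil => simp [IsReduced]
  | cons j w => simp [IsReduced]

/-- The reduced word of `v * b_i`, given that of `v`. -/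
def toggle {n : ℕ} (i : Fin n) : List (Fin n) → List (Fin n)
  | [] => [i]
  | j :: w => if j = i then w else i :: j :: w

theorem toggle_of_mem {n : ℕ} {i : Fin n} {w : List (Fin n)} (hi : i ∈ freeColours w) :
    toggle i w = i :: w := by
  cases w with
  | nil => rfl
  | cons j w =>
    have : j ≠ i := by simpa [eq_comm] using hi
    simp [toggle, this]

theorem toggle_cons_self {n : ℕ} (i : Fin n) (w : List (Fin n)) : toggle i (i :: w) = w := by
  simp [toggle]

theorem eq_cons_of_notMem_freeColours {n : ℕ} {i : Fin n} {w : List (Fin n)}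
    (hi : i ∉ freeColours w) : ∃ w', w = i :: w' := by
  cases w with
  | nil => simp at hi
  | cons j w =>
    have : i = j := by simpa using hi
    exact ⟨w, by rw [this]⟩

theorem IsReduced.toggle {n : ℕ} {w : List (Fin n)} (hw : IsReduced w) (i : Fin n) :
    IsReduced (toggle i w) := by
  by_cases hi : i ∈ freeColours w
  · rw [toggle_of_mem hi]
    exact isReduced_cons.2 ⟨hi, hw⟩
  · obtain ⟨w', rfl⟩ := eq_cons_of_notMem_freeColours hi
    rw [toggle_cons_self]
    exact (isReduced_cons.1 hw).2

theorem IsReduced.toggle_toggle {n : ℕ} {w : List (Fin n)} (hw : IsReduced w) (i : Fin n) :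
    MarkoffHurwitz.toggle i (MarkoffHurwitz.toggle i w) = w := by
  by_cases hi : i ∈ freeColours w
  · rw [toggle_of_mem hi, toggle_cons_self]
  · obtain ⟨w', rfl⟩ := eq_cons_of_notMem_freeColours hi
    rw [toggle_cons_self, toggle_of_mem (isReduced_cons.1 hw).1]

/-- Right multiplication by `b_i` on reduced words. -/
def togglePerm {n : ℕ} (i : Fin n) : Equiv.Perm {w : List (Fin n) // IsReduced w} :=
  Function.Involutive.toPerm (fun w => ⟨toggle i w.1, w.2.toggle i⟩)
    fun w => Subtype.ext (w.2.toggle_toggle i)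

/-- Van der Waerden's trick: the involutions `togglePerm i` let `Γ_n` act on reduced words, which
makes reduced words a normal form. -/
theorem togglePerm_rels {n : ℕ} : ∀ r ∈ gammaRels n, FreeGroup.lift (togglePerm (n := n)) r = 1 := by
  rintro r ⟨i, rfl⟩
  rw [map_pow, FreeGroup.lift_apply_of]
  ext1 w
  rw [pow_two]
  exact Function.Involutive.toPerm_involutive (f := fun w : {w : List (Fin n) // IsReduced w} =>
    (⟨toggle i w.1, w.2.toggle i⟩ : {w : List (Fin n) // IsReduced w}))
    (fun w => Subtype.ext (w.2.toggle_toggle i)) w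

/-- The reduced word of an element of `Γ_n`. -/
def wordOf {n : ℕ} (v : Gamma n) : {w : List (Fin n) // IsReduced w} :=
  PresentedGroup.toGroup togglePerm_rels v⁻¹ ⟨[], isReduced_nil⟩

theorem wordOf_one {n : ℕ} : (wordOf (1 : Gamma n)).1 = [] := by
  simp [wordOf]

theorem gen_inv {n : ℕ} (i : Fin n) : (gen i)⁻¹ = gen i :=
  inv_eq_of_mul_eq_one_left (gen_mul_gen i)

theorem wordOf_mul_gen {n : ℕ} (v : Gamma n) (i : Fin n) :
    (wordOf (v * gen i)).1 = toggle i (wordOf v).1 := by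
  have : PresentedGroup.toGroup togglePerm_rels (gen i) = togglePerm i :=
    PresentedGroup.toGroup.of togglePerm_rels
  -- The inverse in `wordOf` turns right multiplication by `b_i` into applying `togglePerm i` last.
  rw [wordOf, mul_inv_rev, gen_inv, map_mul, this]
  rfl

/-- The element of `Γ_n` spelled by a word, the head of the list being the last letter. -/
def evalWord {n : ℕ} : List (Fin n) → Gamma n
  | [] => 1
  | i :: w => evalWord w * gen i

theorem wordOf_evalWord {n : ℕ} {w : List (Fin n)} (hw : IsReduced w) :
    (wordOf (evalWord w)).1 = w := by
  induction w with
  | nil => exact wordOf_one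
  | cons i w ih =>
    obtain ⟨hi, hw⟩ := isReduced_cons.1 hw
    rw [evalWord, wordOf_mul_gen, ih hw, toggle_of_mem hi]

theorem evalWord_toggle {n : ℕ} (i : Fin n) (w : List (Fin n)) :
    evalWord (toggle i w) = evalWord w * gen i := by
  by_cases hi : i ∈ freeColours w
  · rw [toggle_of_mem hi, evalWord]
  · obtain ⟨w', rfl⟩ := eq_cons_of_notMem_freeColours hi
    rw [toggle_cons_self, evalWord, mul_assoc, gen_mul_gen, mul_one]

theorem evalWord_wordOf {n : ℕ} (v : Gamma n) : evalWord (wordOf v).1 = v := by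
  -- The base point `v` stays general because the product case applies the claim twice in
  -- succession.
  have key : ∀ (l : FreeGroup (Fin n)) (v : Gamma n), evalWord (wordOf v).1 = v →
      evalWord (wordOf (v * PresentedGroup.mk _ l)).1 = v * PresentedGroup.mk _ l := by
    intro l
    have step : ∀ (i : Fin n) (v : Gamma n), evalWord (wordOf v).1 = v →
        evalWord (wordOf (v * gen i)).1 = v * gen i := by
      intro i v hv
      rw [wordOf_mul_gen, evalWord_toggle, hv]
    induction l using FreeGroup.induction_on with
    | C1 => intro v hv; simpa using hv
    | of i => exact step i
    | inv_of i _ =>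
      intro v hv
      rw [map_inv]
      change evalWord (wordOf (v * (gen i)⁻¹)).1 = v * (gen i)⁻¹
      rw [gen_inv]
      exact step i v hv
    | mul a b ha hb =>
      intro v hv
      rw [map_mul, ← mul_assoc]
      exact hb _ (ha v hv)
  obtain ⟨l, rfl⟩ := PresentedGroup.mk_surjective (gammaRels n) v
  have := key l 1 (by rw [wordOf_one]; rfl)
  simpa using this

/-! ### Gates of regular subtrees -/

/-- The word of the vertex closest to the root in the regular subtree with colours `I` through
the vertex with word `w`. -/
def gateWord {n : ℕ} (I : Finset (Fin n)) (w : List (Fin n)) : List (Fin n) :=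
  w.dropWhile (· ∈ I)

theorem gateWord_cons_of_mem {n : ℕ} {I : Finset (Fin n)} {i : Fin n} (hi : i ∈ I)
    (w : List (Fin n)) : gateWord I (i :: w) = gateWord I w := by
  simp [gateWord, hi]

theorem gateWord_of_subset {n : ℕ} {I : Finset (Fin n)} {w : List (Fin n)}
    (h : I ⊆ freeColours w) : gateWord I w = w := by
  cases w with
  | nil => rfl
  | cons i w =>
    have : i ∉ I := fun hi => by simpa using h hi
    simp [gateWord, this]

theorem subset_freeColours_gateWord {n : ℕ} (I : Finset (Fin n)) (w : List (Fin n)) :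
    I ⊆ freeColours (gateWord I w) := by
  induction w with
  | nil => simp [gateWord]
  | cons i w ih =>
    by_cases hi : i ∈ I
    · rwa [gateWord_cons_of_mem hi]
    · simp only [gateWord, List.dropWhile_cons, hi, decide_false, Bool.false_eq_true, if_false,
        freeColours_cons]
      intro j hj
      simp only [Finset.mem_erase, Finset.mem_univ, and_true]
      rintro rfl
      exact hi hj

theorem IsReduced.gateWord {n : ℕ} {w : List (Fin n)} (hw : IsReduced w) (I : Finset (Fin n)) :
    IsReduced (gateWord I w) :=
  List.IsChain.suffix hw (List.dropWhile_suffix _)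

theorem gateWord_toggle {n : ℕ} {I : Finset (Fin n)} {i : Fin n} (hi : i ∈ I)
    (w : List (Fin n)) : gateWord I (toggle i w) = gateWord I w := by
  by_cases h : i ∈ freeColours w
  · rw [toggle_of_mem h, gateWord_cons_of_mem hi]
  · obtain ⟨w', rfl⟩ := eq_cons_of_notMem_freeColours h
    rw [toggle_cons_self, gateWord_cons_of_mem hi]

theorem reachable_gateWord {n : ℕ} (I : Finset (Fin n)) (w : List (Fin n)) :
    (colourGraph n I).Reachable (evalWord (gateWord I w)) (evalWord w) := by
  induction w with
  | nil => rfl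
  | cons i w ih =>
    by_cases hi : i ∈ I
    · rw [gateWord_cons_of_mem hi]
      exact ih.trans (SimpleGraph.Adj.reachable ⟨i, hi, rfl⟩)
    · simp [gateWord, hi]

/-- Steps with colours in `I` do not change the gate. Together with `reachable_gateWord` this makes
the gate a complete invariant of a component. -/
theorem gateWord_wordOf_eq_of_reachable {n : ℕ} {I : Finset (Fin n)} {v w : Gamma n}
    (h : (colourGraph n I).Reachable v w) :
    gateWord I (wordOf v).1 = gateWord I (wordOf w).1 := by
  obtain ⟨p⟩ := h
  induction p with
  | nil => rfl
  | cons h _ ih =>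
    obtain ⟨i, hi, rfl⟩ := h
    rw [← ih, wordOf_mul_gen, gateWord_toggle hi]

theorem regSubtree_evalWord_injective {n k : ℕ} {w w' : List (Fin n)} {I I' : Finset (Fin n)}
    {hI : I.card = k} {hI' : I'.card = k} (hw : IsReduced w) (hw' : IsReduced w')
    (hs : I ⊆ freeColours w) (hs' : I' ⊆ freeColours w')
    (h : regSubtree (evalWord w) I hI = regSubtree (evalWord w') I' hI') : w = w' ∧ I = I' := by
  have h1 : I = I' := congrArg (fun T : RegSubtree n k => T.1.1) h
  subst h1
  have h2 : (colourGraph n I).connectedComponentMk (evalWord w) =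
      (colourGraph n I).connectedComponentMk (evalWord w') :=
    eq_of_heq (Sigma.mk.inj_iff.1 h).2
  have h3 := gateWord_wordOf_eq_of_reachable (SimpleGraph.ConnectedComponent.eq.1 h2)
  rw [wordOf_evalWord hw, wordOf_evalWord hw', gateWord_of_subset hs, gateWord_of_subset hs'] at h3
  exact ⟨h3, rfl⟩

theorem exists_gate {n k : ℕ} (T : RegSubtree n k) :
    ∃ (w : List (Fin n)) (I : Finset (Fin n)) (hI : I.card = k), IsReduced w ∧
      I ⊆ freeColours w ∧ regSubtree (evalWord w) I hI = T := by
  obtain ⟨⟨I, hI⟩, c⟩ := T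
  induction c using SimpleGraph.ConnectedComponent.ind with
  | h v =>
    refine ⟨gateWord I (wordOf v).1, I, hI, (wordOf v).2.gateWord I,
      subset_freeColours_gateWord I _, ?_⟩
    have := reachable_gateWord I (wordOf v).1
    rw [evalWord_wordOf] at this
    simp only [regSubtree]
    rw [SimpleGraph.ConnectedComponent.eq.2 this]

/-! ### Levels of the tree -/

/-- The reduced words of length `m`. -/
def level (n : ℕ) : ℕ → Finset (List (Fin n))
  | 0 => {[]}
  | m + 1 => ((level n m).sigma fun w => freeColours w).image fun p => p.2 :: p.1

theorem mem_level {n m : ℕ} {w : List (Fin n)} : w ∈ level n m ↔ IsReduced w ∧ w.length = m := by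
  induction m generalizing w with
  | zero =>
    simp only [level, Finset.mem_singleton, List.length_eq_zero_iff]
    exact ⟨fun h => ⟨h ▸ isReduced_nil, h⟩, fun h => h.2⟩
  | succ m ih =>
    simp only [level, Finset.mem_image, Finset.mem_sigma, Sigma.exists]
    constructor
    · rintro ⟨w, i, ⟨hw, hi⟩, rfl⟩
      exact ⟨isReduced_cons.2 ⟨hi, (ih.1 hw).1⟩, by simp [(ih.1 hw).2]⟩
    · rintro ⟨hw, hl⟩
      obtain ⟨i, w', rfl⟩ := List.exists_cons_of_length_eq_add_one hl
      obtain ⟨hi, hw⟩ := isReduced_cons.1 hw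
      exact ⟨w', i, ⟨ih.2 ⟨hw, by simpa using hl⟩, hi⟩, rfl⟩

theorem sum_level_succ {n m : ℕ} {M : Type*} [AddCommMonoid M] (f : List (Fin n) → M) :
    ∑ u ∈ level n (m + 1), f u = ∑ w ∈ level n m, ∑ i ∈ freeColours w, f (i :: w) := by
  rw [level, Finset.sum_image, Finset.sum_sigma]
  rintro ⟨w, i⟩ - ⟨w', i'⟩ - h
  obtain ⟨rfl, rfl⟩ : i = i' ∧ w = w' := by simpa using h
  rfl

/-- The vertices of the tree, sorted by level. -/
def vertexEquiv (n : ℕ) : (Σ m : ℕ, {w // w ∈ level n m}) ≃ Gamma n where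
  toFun p := evalWord p.2.1
  invFun v := ⟨_, (wordOf v).1, mem_level.2 ⟨(wordOf v).2, rfl⟩⟩
  left_inv := by
    rintro ⟨m, w, hw⟩
    obtain ⟨hr, rfl⟩ := mem_level.1 hw
    have := wordOf_evalWord hr
    ext
    · simp [this]
    · simp [this]
  right_inv v := evalWord_wordOf v

/-- The alternating geodesics, sorted by their gates. -/
def geodesicEquiv (n : ℕ) :
    (Σ p : (Σ m : ℕ, {w // w ∈ level n m}),
      {I // I ∈ Finset.powersetCard 2 (freeColours p.2.1)}) ≃ A n :=
  Equiv.ofBijective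
    (fun q => regSubtree (evalWord q.1.2.1) q.2.1 (Finset.mem_powersetCard.1 q.2.2).2) (by
      constructor
      · rintro ⟨⟨m, w, hw⟩, I, hI⟩ ⟨⟨m', w', hw'⟩, I', hI'⟩ h
        obtain ⟨hr, rfl⟩ := mem_level.1 hw
        obtain ⟨hr', rfl⟩ := mem_level.1 hw'
        obtain ⟨rfl, rfl⟩ := regSubtree_evalWord_injective hr hr'
          (Finset.mem_powersetCard.1 hI).1 (Finset.mem_powersetCard.1 hI').1 h
        rfl
      · intro T
        obtain ⟨w, I, hI, hw, hs, rfl⟩ := exists_gate T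
        exact ⟨⟨⟨w.length, w, mem_level.2 ⟨hw, rfl⟩⟩, I, Finset.mem_powersetCard.2 ⟨hs, hI⟩⟩, rfl⟩)

/-! ### The function `h` and linear recurrences -/

theorem complexSqrt_sq (a : ℂ) : Complex.sqrt a ^ 2 = a := by
  have := Complex.cpow_nat_inv_pow a two_ne_zero
  simpa only [Complex.sqrt, Nat.cast_ofNat] using this

theorem re_sqrt_nonneg (a : ℂ) : 0 ≤ (Complex.sqrt a).re := by
  rw [Complex.sqrt, Complex.cpow_inv_two_re]
  exact Real.sqrt_nonneg _

/-- The contribution of one end of a geodesic with value `z`. -/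
def eta (z : ℂ) : ℂ := h z / 2

theorem eta_mul_one_sub (z : ℂ) : eta z * (1 - eta z) = 1 / z ^ 2 := by
  have := complexSqrt_sq (1 - 4 / z ^ 2)
  simp only [eta, h]
  linear_combination (-1 / 4) * this

theorem re_eta_le (z : ℂ) : (eta z).re ≤ 1 / 2 := by
  have := re_sqrt_nonneg (1 - 4 / z ^ 2)
  simp only [eta, h, Complex.div_ofNat_re, Complex.sub_re, Complex.one_re]
  linarith

/-- `η` and `1 - η` are the two roots of `t(1 - t) = 1 / z²`; the choice of square root puts `η` in
the half plane `Re ≤ 1/2`, closer to `0` than to `1`. -/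
theorem norm_eta_le_norm_one_sub (z : ℂ) : ‖eta z‖ ≤ ‖1 - eta z‖ := by
  have h1 := re_eta_le z
  rw [← sq_le_sq₀ (norm_nonneg _) (norm_nonneg _), Complex.sq_norm, Complex.sq_norm,
    Complex.normSq_apply, Complex.normSq_apply]
  simp only [Complex.sub_re, Complex.one_re, Complex.sub_im, Complex.one_im]
  nlinarith

theorem norm_eta_mul_norm (z : ℂ) : ‖eta z‖ * ‖1 - eta z‖ = 1 / ‖z‖ ^ 2 := by
  rw [← norm_mul, eta_mul_one_sub, norm_div, norm_one, norm_pow]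

theorem norm_eta_le (z : ℂ) : ‖eta z‖ ≤ 1 / ‖z‖ := by
  have h1 := norm_eta_mul_norm z
  have h2 := norm_eta_le_norm_one_sub z
  have h3 := norm_nonneg (eta z)
  rw [← sq_le_sq₀ h3 (by positivity), div_pow, one_pow, ← h1]
  nlinarith

/-- The roots of `t² - z t + 1` are `l` and `l⁻¹`. On the unit circle they would be conjugate, and
`z = 2 Re l` would lie in `[-2, 2]`. -/
theorem exists_norm_gt_one_add_inv {z : ℂ} (hz : z ∉ ((↑) : ℝ → ℂ) '' Set.Icc (-2) 2) :
    ∃ l : ℂ, 1 < ‖l‖ ∧ l + l⁻¹ = z := by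
  obtain ⟨s, hs⟩ := IsAlgClosed.exists_pow_nat_eq (z ^ 2 - 4) (n := 2) two_pos
  have hprod : ((z + s) / 2) * ((z - s) / 2) = 1 := by linear_combination (-1 / 4) * hs
  have hsum : ((z + s) / 2) + ((z - s) / 2) = z := by ring
  generalize (z + s) / 2 = l at hprod hsum
  generalize (z - s) / 2 = l' at hprod hsum
  have hl' : l' = l⁻¹ := eq_inv_of_mul_eq_one_right hprod
  have hl : l = l'⁻¹ := eq_inv_of_mul_eq_one_left hprod
  rcases lt_trichotomy ‖l‖ 1 with h | h | h
  · refine ⟨l', ?_, by rw [← hl, add_comm, hsum]⟩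
    have hl0 : 0 < ‖l‖ := norm_pos_iff.2 (left_ne_zero_of_mul_eq_one hprod)
    rw [hl', norm_inv]
    exact (one_lt_inv₀ hl0).2 h
  · exfalso
    apply hz
    rw [Complex.inv_eq_conj h] at hl'
    have h1 := Complex.abs_re_le_norm l
    rw [h, abs_le] at h1
    refine ⟨2 * l.re, ⟨by linarith, by linarith⟩, ?_⟩
    rw [← hsum, hl', Complex.add_conj]
  · exact ⟨l, h, by rw [← hl', hsum]⟩

/-- With `z = l + l⁻¹`, the bound `|η(z)| ≤ 1 / |z|` excludes the root `l / z`. -/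
theorem eta_ne_of_one_lt_norm {l : ℂ} (hl : 1 < ‖l‖) (hz : l + l⁻¹ ≠ 0) :
    l / (l + l⁻¹) ≠ eta (l + l⁻¹) := by
  intro h
  have h1 := norm_eta_le (l + l⁻¹)
  rw [← h, norm_div, div_le_div_iff_of_pos_right (norm_pos_iff.2 hz)] at h1
  linarith

/-- Solve the recurrence as `y m = a l ^ m + b l⁻¹ ^ m`. The lower bound on `‖y m‖` rules out `a =
0`, so the growing term dominates. -/
theorem exists_tendsto_ratio {z : ℂ} (hz : z ∉ ((↑) : ℝ → ℂ) '' Set.Icc (-2) 2) {y : ℕ → ℂ}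
    (hy : ∀ m, y (m + 2) = z * y (m + 1) - y m) {ε : ℝ} (hε : 0 < ε)
    (hl : ∀ᶠ m in atTop, ε ≤ ‖y m‖) :
    ∃ l : ℂ, 1 < ‖l‖ ∧ l + l⁻¹ = z ∧ Tendsto (fun m => y (m + 1) / y m) atTop (𝓝 l) := by
  obtain ⟨l, hl1, rfl⟩ := exists_norm_gt_one_add_inv hz
  refine ⟨l, hl1, rfl, ?_⟩
  have hl0 : l ≠ 0 := by
    rintro rfl
    simp at hl1
    linarith
  have hd : l - l⁻¹ ≠ 0 := by
    intro h
    have h1 : l * l = 1 := by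
      have := sub_eq_zero.1 h
      nth_rewrite 2 [this]
      exact mul_inv_cancel₀ hl0
    have h2 : ‖l‖ * ‖l‖ = 1 := by rw [← norm_mul, h1, norm_one]
    nlinarith
  obtain ⟨a, ha⟩ : ∃ a, a * (l - l⁻¹) = y 1 - l⁻¹ * y 0 :=
    ⟨(y 1 - l⁻¹ * y 0) / (l - l⁻¹), div_mul_cancel₀ _ hd⟩
  set b := y 0 - a with hb
  have hform : ∀ m, y m = a * l ^ m + b * l⁻¹ ^ m := by
    intro m
    induction m using Nat.twoStepInduction with
    | zero => simp [hb]
    | one => rw [hb]; linear_combination -ha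
    | more m h1 h2 =>
      rw [hy, h1, h2]
      have : l * l⁻¹ = 1 := mul_inv_cancel₀ hl0
      ring_nf
      linear_combination (a * l ^ m + b * l⁻¹ ^ m) * this
  have hinv : ‖l⁻¹‖ < 1 := by
    rw [norm_inv]
    exact inv_lt_one_of_one_lt₀ hl1
  have ha0 : a ≠ 0 := by
    intro h
    have h1 : Tendsto (fun m => ‖y m‖) atTop (𝓝 0) := by
      have h2 : Tendsto (fun m => ‖b * l⁻¹ ^ m‖) atTop (𝓝 ‖b * 0‖) :=
        ((tendsto_pow_atTop_nhds_zero_of_norm_lt_one hinv).const_mul b).norm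
      simpa [hform, h] using h2
    have h3 := ge_of_tendsto h1 hl
    linarith
  have hq : ‖l⁻¹ ^ 2‖ < 1 := by
    rw [norm_pow]
    exact pow_lt_one₀ (norm_nonneg _) hinv two_ne_zero
  have hq' := tendsto_pow_atTop_nhds_zero_of_norm_lt_one hq
  have hlim : Tendsto (fun m => (a * l + b * l⁻¹ * (l⁻¹ ^ 2) ^ m) / (a + b * (l⁻¹ ^ 2) ^ m)) atTop
      (𝓝 ((a * l + b * l⁻¹ * 0) / (a + b * 0))) :=
    ((hq'.const_mul _).const_add _).div ((hq'.const_mul _).const_add _) (by simpa using ha0)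
  have hval : (a * l + b * l⁻¹ * 0) / (a + b * 0) = l := by
    rw [mul_zero, mul_zero, add_zero, add_zero, mul_div_cancel_left₀ _ ha0]
  rw [hval] at hlim
  refine hlim.congr fun m => ?_
  have hlm : l ^ m ≠ 0 := pow_ne_zero _ hl0
  have hm : l ^ m * l⁻¹ ^ m = 1 := by rw [← mul_pow, mul_inv_cancel₀ hl0, one_pow]
  have e1 : a * l ^ (m + 1) + b * l⁻¹ ^ (m + 1) =
      l ^ m * (a * l + b * l⁻¹ * (l⁻¹ ^ 2) ^ m) := by
    rw [← pow_mul, mul_comm 2 m, pow_mul]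
    linear_combination (-(b * l⁻¹ * l⁻¹ ^ m)) * hm
  have e2 : a * l ^ m + b * l⁻¹ ^ m = l ^ m * (a + b * (l⁻¹ ^ 2) ^ m) := by
    rw [← pow_mul, mul_comm 2 m, pow_mul]
    linear_combination (-(b * l⁻¹ ^ m)) * hm
  rw [hform, hform, e1, e2, mul_div_mul_left _ _ hlm]

/-- Quantitative expansion of two consecutive values `a`, `b` along a geodesic of value `z`. -/
structure Expanding (κ : ℝ) (z a b : ℂ) : Prop where
  le_norm : κ ≤ ‖z‖
  one_add : (1 + κ) * ‖a‖ ≤ ‖b‖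
  half : 1 / 2 * ‖z * a‖ ≤ ‖b‖
  sep : κ ≤ ‖b / (z * a) - eta z‖

/-- All four conditions hold in the limit with strict inequality. Stating this for all small `κ`
allows finitely many rays to share one `κ`. -/
theorem eventually_expanding {z : ℂ} (hz : z ∉ ((↑) : ℝ → ℂ) '' Set.Icc (-2) 2) {y : ℕ → ℂ}
    (hy : ∀ m, y (m + 2) = z * y (m + 1) - y m) {ε : ℝ} (hε : 0 < ε)
    (hl : ∀ᶠ m in atTop, ε ≤ ‖y m‖) :
    ∀ᶠ κ : ℝ in 𝓝[>] 0, ∀ᶠ m in atTop, Expanding κ z (y m) (y (m + 1)) := by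
  obtain ⟨l, hl1, hlz, hlim⟩ := exists_tendsto_ratio hz hy hε hl
  have hz0 : z ≠ 0 := by
    rintro rfl
    exact hz ⟨0, by norm_num, by simp⟩
  have hne : l / z ≠ eta z := by
    rw [← hlz] at hz0 ⊢
    exact eta_ne_of_one_lt_norm hl1 hz0
  have hlt : ∀ c : ℝ, 0 < c → ∀ᶠ κ : ℝ in 𝓝[>] 0, κ < c := fun c hc =>
    (eventually_lt_nhds hc).filter_mono nhdsWithin_le_nhds
  have hhalf : 1 / 2 * ‖z‖ < ‖l‖ := by
    have h1 : ‖z‖ ≤ ‖l‖ + ‖l⁻¹‖ := hlz ▸ norm_add_le _ _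
    have h2 : ‖l⁻¹‖ < 1 := by
      rw [norm_inv]
      exact inv_lt_one_of_one_lt₀ hl1
    linarith
  filter_upwards [hlt _ (norm_pos_iff.2 hz0), hlt (‖l‖ - 1) (by linarith),
    hlt _ (norm_pos_iff.2 (sub_ne_zero.2 hne))] with κ h1 h2 h3
  have t1 := hlim.norm
  have t2 := ((hlim.div_const z).sub_const (eta z)).norm
  filter_upwards [hl, t1.eventually_const_lt (show 1 + κ < ‖l‖ by linarith),
    t1.eventually_const_lt hhalf, t2.eventually_const_lt h3] with m g0 g1 g2 g3
  have hpos : 0 < ‖y m‖ := hε.trans_le g0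
  rw [norm_div, lt_div_iff₀ hpos] at g1 g2
  refine ⟨h1.le, g1.le, ?_, ?_⟩
  · rw [norm_mul]
    linarith
  · rw [mul_comm z, ← div_div]
    exact g3.le

/-! ### Hurwitz maps on words -/

/-- The product of the values at `w` of all colours but `i`. -/
def edgeProd {n : ℕ} (x : List (Fin n) → Fin n → ℂ) (w : List (Fin n)) (i : Fin n) : ℂ :=
  ∏ j ∈ Finset.univ.erase i, x w j

/-- The value of the alternating geodesic with colours `i`, `j` through `w`. -/
def geo {n : ℕ} (x : List (Fin n) → Fin n → ℂ) (w : List (Fin n)) (i j : Fin n) : ℂ :=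
  ∏ k ∈ ({i, j} : Finset (Fin n))ᶜ, x w k

/-- A `μ`-Hurwitz map satisfying the Bowditch conditions, read on words: away from the root all
geodesics through `w` with gate `w` have values larger than `K`. -/
structure IsBowditchWordMap {n : ℕ} (μ : ℂ) (K : ℝ) (R : ℕ) (x : List (Fin n) → Fin n → ℂ) :
    Prop where
  three_le : 3 ≤ n
  two_lt : 2 < K
  cons_ne : ∀ w {i j}, j ≠ i → x (i :: w) j = x w j
  edge : ∀ w i, x w i + x (i :: w) i = edgeProd x w i
  vertex : ∀ w, ∑ i, x w i ^ 2 - ∏ i, x w i = μ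
  notMem : ∀ w {i j}, i ≠ j → geo x w i j ∉ ((↑) : ℝ → ℂ) '' Set.Icc (-2) 2
  large : ∀ {w}, IsReduced w → R ≤ w.length → ∀ {i j}, i ∈ freeColours w → j ∈ freeColours w →
    i ≠ j → K < ‖geo x w i j‖

theorem geo_comm {n : ℕ} (x : List (Fin n) → Fin n → ℂ) (w : List (Fin n)) (i j : Fin n) :
    geo x w i j = geo x w j i := by
  rw [geo, geo, Finset.pair_comm]

theorem mul_geo {n : ℕ} (x : List (Fin n) → Fin n → ℂ) (w : List (Fin n)) {i j : Fin n}
    (hij : i ≠ j) : x w j * geo x w i j = edgeProd x w i := by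
  have h1 : ({i, j} : Finset (Fin n))ᶜ = (Finset.univ.erase i).erase j := by
    ext k; simp [and_comm]
  rw [geo, h1, edgeProd, Finset.mul_prod_erase _ _ (by simpa using hij.symm)]

theorem mul_edgeProd {n : ℕ} (x : List (Fin n) → Fin n → ℂ) (w : List (Fin n)) (i : Fin n) :
    x w i * edgeProd x w i = ∏ k, x w k :=
  Finset.mul_prod_erase _ _ (Finset.mem_univ i)

theorem exists_ne_ne {n : ℕ} (hn : 3 ≤ n) (i j : Fin n) : ∃ k, k ≠ i ∧ k ≠ j := by
  have : ({i, j} : Finset (Fin n)).card < (Finset.univ : Finset (Fin n)).card := by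
    rw [Finset.card_univ, Fintype.card_fin]
    exact Finset.card_le_two.trans_lt hn
  obtain ⟨k, -, hk⟩ := Finset.exists_mem_notMem_of_card_lt_card this
  simp only [Finset.mem_insert, Finset.mem_singleton, not_or] at hk
  exact ⟨k, hk⟩

namespace IsBowditchWordMap

variable {n : ℕ} {μ : ℂ} {K : ℝ} {R : ℕ} {x : List (Fin n) → Fin n → ℂ}

theorem geo_ne_zero (H : IsBowditchWordMap μ K R x) (w : List (Fin n)) {i j : Fin n}
    (hij : i ≠ j) : geo x w i j ≠ 0 := fun h =>
  H.notMem w hij ⟨0, by norm_num, by simp [h]⟩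

theorem ne_zero (H : IsBowditchWordMap μ K R x) (w : List (Fin n)) (k : Fin n) : x w k ≠ 0 := by
  obtain ⟨i, hi, -⟩ := exists_ne_ne H.three_le k k
  obtain ⟨j, hj, hji⟩ := exists_ne_ne H.three_le k i
  exact Finset.prod_ne_zero_iff.1 (H.geo_ne_zero w hji) k (by simp [hi.symm, hj.symm])

theorem edgeProd_ne_zero (H : IsBowditchWordMap μ K R x) (w : List (Fin n)) (i : Fin n) :
    edgeProd x w i ≠ 0 :=
  Finset.prod_ne_zero_iff.2 fun j _ => H.ne_zero w j

theorem edgeProd_cons (H : IsBowditchWordMap μ K R x) (w : List (Fin n)) (i : Fin n) :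
    edgeProd x (i :: w) i = edgeProd x w i :=
  Finset.prod_congr rfl fun _ hj => H.cons_ne w (Finset.ne_of_mem_erase hj)

theorem geo_cons (H : IsBowditchWordMap μ K R x) (w : List (Fin n)) (i j : Fin n) :
    geo x (i :: w) i j = geo x w i j :=
  Finset.prod_congr rfl fun k hk => H.cons_ne w (by
    rintro rfl
    simp at hk)

/-- The geodesic with colours `j, k` is born at `i :: w`. This is the division-free form of `z_{jk}
= x_i' z_{ik} / x_j`, the source of submultiplicativity. -/
theorem geo_cons_mul (H : IsBowditchWordMap μ K R x) (w : List (Fin n)) {i j k : Fin n}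
    (hij : i ≠ j) (hik : i ≠ k) (hjk : j ≠ k) :
    geo x (i :: w) j k * x w j = x (i :: w) i * geo x w i k := by
  have e1 : x (i :: w) i * ∏ l ∈ (({j, k} : Finset (Fin n))ᶜ).erase i, x (i :: w) l =
      geo x (i :: w) j k := Finset.mul_prod_erase _ _ (by simp [hij, hik])
  have e2 : x w j * ∏ l ∈ (({i, k} : Finset (Fin n))ᶜ).erase j, x w l =
      geo x w i k := Finset.mul_prod_erase _ _ (by simp [hij.symm, hjk])
  have e3 : (({j, k} : Finset (Fin n))ᶜ).erase i = (({i, k} : Finset (Fin n))ᶜ).erase j := by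
    ext l; simp; tauto
  have e4 : ∏ l ∈ (({j, k} : Finset (Fin n))ᶜ).erase i, x (i :: w) l =
      ∏ l ∈ (({i, k} : Finset (Fin n))ᶜ).erase j, x w l := by
    rw [← e3]
    exact Finset.prod_congr rfl fun l hl => H.cons_ne w (Finset.ne_of_mem_erase hl)
  rw [← e1, ← e2, e4]
  ring

theorem edgeProd_cons_ne (H : IsBowditchWordMap μ K R x) (w : List (Fin n)) {i j : Fin n}
    (hij : i ≠ j) : edgeProd x (i :: w) j = x (i :: w) i * geo x w i j := by
  rw [← mul_geo x (i :: w) hij.symm, geo_comm, H.geo_cons]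

end IsBowditchWordMap

/-- The edge from `w` to `i :: w` is good if the new value is not much smaller than it has to be. -/
def Good {n : ℕ} (x : List (Fin n) → Fin n → ℂ) (w : List (Fin n)) (i : Fin n) : Prop :=
  1 / 2 * ‖edgeProd x w i‖ ≤ ‖x (i :: w) i‖

namespace IsBowditchWordMap

variable {n : ℕ} {μ : ℂ} {K : ℝ} {R : ℕ} {x : List (Fin n) → Fin n → ℂ}

/-- Goodness propagates outwards across a large geodesic: it gives `2 |x_j| ≤ |x_i' z|`, so in `x_j
+ x_j' = x_i' z` the new value takes at least half. -/
theorem good_cons (H : IsBowditchWordMap μ K R x) {w : List (Fin n)} {i j : Fin n}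
    (hij : i ≠ j) (hz : 2 < ‖geo x w i j‖) (hg : Good x w i) : Good x (i :: w) j := by
  have h1 := H.edge (i :: w) j
  rw [H.cons_ne w hij.symm] at h1
  have h2 : ‖edgeProd x (i :: w) j‖ ≤ ‖x w j‖ + ‖x (j :: i :: w) j‖ := by
    rw [← h1]
    exact norm_add_le _ _
  rw [Good, ← mul_geo x w hij, norm_mul] at hg
  have h3 : ‖edgeProd x (i :: w) j‖ = ‖x (i :: w) i‖ * ‖geo x w i j‖ := by
    rw [H.edgeProd_cons_ne w hij, norm_mul]
  rw [Good]
  have h4 := norm_nonneg (x w j)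
  have h5 : 2 * ‖x w j‖ ≤ ‖x (i :: w) i‖ * ‖geo x w i j‖ := by
    nlinarith [mul_le_mul_of_nonneg_right hg (norm_nonneg (geo x w i j)),
      mul_nonneg h4 (sub_nonneg.2 hz.le), mul_nonneg (mul_nonneg h4 (sub_nonneg.2 hz.le))
        (norm_nonneg (geo x w i j))]
  linarith

/-- Badness of the second edge gives `K/2 · |x_i'| ≤ |x_j|`, that of the first `|x_j| ≤ |x_i|`. The
two vertex products differ only in the factors `x_i'` and `x_i`. -/
theorem norm_prod_le_of_not_good (H : IsBowditchWordMap μ K R x) {w : List (Fin n)} {i j : Fin n}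
    (hij : i ≠ j) (hz : K < ‖geo x w i j‖) (h1 : ¬ Good x w i) (h2 : ¬ Good x (i :: w) j) :
    K / 2 * ‖∏ k, x (i :: w) k‖ ≤ ‖∏ k, x w k‖ := by
  have hK := H.two_lt
  rw [← mul_edgeProd x w i, ← mul_edgeProd x (i :: w) i, H.edgeProd_cons, norm_mul, norm_mul,
    ← mul_assoc]
  refine mul_le_mul_of_nonneg_right ?_ (norm_nonneg _)
  have e1 : ‖edgeProd x w i‖ ≤ ‖x w i‖ + ‖x (i :: w) i‖ := by
    rw [← H.edge]
    exact norm_add_le _ _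
  have e2 : ‖edgeProd x (i :: w) j‖ ≤ ‖x w j‖ + ‖x (j :: i :: w) j‖ := by
    rw [← H.edge, H.cons_ne w hij.symm]
    exact norm_add_le _ _
  rw [Good, not_le] at h1 h2
  have e3 : ‖edgeProd x (i :: w) j‖ = ‖x (i :: w) i‖ * ‖geo x w i j‖ := by
    rw [H.edgeProd_cons_ne w hij, norm_mul]
  have e4 : ‖edgeProd x w i‖ = ‖x w j‖ * ‖geo x w i j‖ := by
    rw [← mul_geo x w hij, norm_mul]
  have p1 := norm_nonneg (x w j)
  have p2 := norm_nonneg (x (i :: w) i)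
  have f1 : K / 2 * ‖x (i :: w) i‖ ≤ ‖x w j‖ := by nlinarith
  have f2 : ‖x w j‖ ≤ ‖x w i‖ := by nlinarith
  linarith

/-- Let `x_j` be the largest value with `j ≠ i`. The geodesic `{i, j}` omits it, so if all the other
values were below `c ≤ 1`, that product would be too. -/
theorem exists_pair_le_norm (H : IsBowditchWordMap μ K R x) {w : List (Fin n)} {i : Fin n} {c : ℝ}
    (hc1 : c ≤ 1) (hc : ∀ j, j ≠ i → c ≤ ‖geo x w i j‖) :
    ∃ j k, j ≠ i ∧ k ≠ i ∧ j ≠ k ∧ c ≤ ‖x w j‖ ∧ c ≤ ‖x w k‖ := by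
  obtain ⟨j₀, hj₀, -⟩ := exists_ne_ne H.three_le i i
  obtain ⟨j, hj, hmax⟩ := Finset.exists_max_image (Finset.univ.erase i) (fun j => ‖x w j‖)
    ⟨j₀, by simpa using hj₀⟩
  have hji : j ≠ i := Finset.ne_of_mem_erase hj
  obtain ⟨k, hki, hkj, hk⟩ : ∃ k, k ≠ i ∧ k ≠ j ∧ c ≤ ‖x w k‖ := by
    by_contra! hcon
    obtain ⟨k, hki, hkj⟩ := exists_ne_ne H.three_le i j
    have h1 := hc j hji
    rw [geo, ← Finset.mul_prod_erase _ _ (show k ∈ ({i, j} : Finset (Fin n))ᶜ by simp [hki, hkj]),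
      norm_mul, norm_prod] at h1
    have h2 : ∏ l ∈ (({i, j} : Finset (Fin n))ᶜ).erase k, ‖x w l‖ ≤ 1 := by
      refine Finset.prod_le_one (fun _ _ => norm_nonneg _) fun l hl => ?_
      simp only [Finset.mem_erase, Finset.mem_compl, Finset.mem_insert, Finset.mem_singleton,
        not_or] at hl
      exact (hcon l hl.2.1 hl.2.2).le.trans hc1
    have h3 := hcon k hki hkj
    have h4 := mul_le_of_le_one_right (norm_nonneg (x w k)) h2
    linarith
  exact ⟨j, k, hji, hki, hkj.symm, hk.trans (hmax k (by simpa using hki)), hk⟩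

/-- On a bad edge the old value has `|x_i| ≥ |P| / 2`, and `|P| ≥ 1`, so `|x_i P| ≥ 1/2`. -/
theorem half_le_norm_prod_of_not_good (H : IsBowditchWordMap μ K R x) {w : List (Fin n)}
    {i : Fin n} (hz : ∀ j, j ≠ i → K < ‖geo x w i j‖) (hg : ¬ Good x w i) :
    1 / 2 ≤ ‖∏ k, x w k‖ := by
  have hK := H.two_lt
  obtain ⟨j, -, hj, -, -, h1, -⟩ := H.exists_pair_le_norm (w := w) (i := i) le_rfl
    fun j hj => by linarith [hz j hj]
  have e1 : ‖edgeProd x w i‖ ≤ ‖x w i‖ + ‖x (i :: w) i‖ := by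
    rw [← H.edge]
    exact norm_add_le _ _
  rw [Good, not_le] at hg
  have e2 : ‖edgeProd x w i‖ = ‖x w j‖ * ‖geo x w i j‖ := by
    rw [← mul_geo x w hj.symm, norm_mul]
  have e3 := hz j hj
  have e4 : 1 ≤ ‖edgeProd x w i‖ := by rw [e2]; nlinarith
  rw [← mul_edgeProd x w i, norm_mul]
  nlinarith

theorem pow_mul_norm_prod_le (H : IsBowditchWordMap μ K R x) {L : ℕ}
    (hL : ∀ w i, IsReduced (i :: w) → L ≤ w.length → ¬ Good x w i →
      ∀ j, j ≠ i → K < ‖geo x w i j‖) (t : ℕ) :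
    ∀ w i, IsReduced (i :: w) → w.length = L + t → ¬ Good x w i →
      (K / 2) ^ t * ‖∏ k, x w k‖ ≤ ‖∏ k, x (w.drop t) k‖ := by
  have hK := H.two_lt
  induction t with
  | zero => intro w i _ _ _; simp
  | succ t ih =>
    intro w i hr hl hg
    obtain ⟨l, w, rfl⟩ := List.exists_cons_of_length_eq_add_one (n := L + t) hl
    have hli : l ≠ i := by
      have := (isReduced_cons.1 hr).1
      simpa [eq_comm] using this
    have hz : K < ‖geo x w l i‖ := by
      have := hL _ i hr (by omega) hg l hli
      rwa [geo_comm, H.geo_cons] at this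
    -- Badness propagates towards the root, by the contrapositive of `good_cons`.
    have hg' : ¬ Good x w l := fun h => hg (H.good_cons hli (hK.trans hz) h)
    have h1 := H.norm_prod_le_of_not_good hli hz hg' hg
    have h2 := ih w l (isReduced_cons.1 hr).2 (by rw [List.length_cons] at hl; omega) hg'
    rw [List.drop_succ_cons]
    refine le_trans ?_ h2
    rw [pow_succ, mul_assoc]
    exact mul_le_mul_of_nonneg_left h1 (pow_nonneg (by linarith) _)

/-- A bad edge `s` levels below level `L` forces a product of norm at least `(K / 2) ^ s / 2` at its
ancestor on level `L`, where only finitely many products occur. -/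
theorem exists_forall_good (H : IsBowditchWordMap μ K R x) {L : ℕ}
    (hL : ∀ w i, IsReduced (i :: w) → L ≤ w.length → ¬ Good x w i →
      ∀ j, j ≠ i → K < ‖geo x w i j‖) :
    ∃ L', L ≤ L' ∧ ∀ w i, IsReduced (i :: w) → L' ≤ w.length → Good x w i := by
  have hK := H.two_lt
  obtain ⟨M, hM⟩ := ((List.finite_length_eq (Fin n) L).image fun w => ‖∏ k, x w k‖).bddAbove
  obtain ⟨t, ht⟩ := pow_unbounded_of_one_lt (2 * M) (show 1 < K / 2 by linarith)
  refine ⟨L + t, by omega, fun w i hr hl => ?_⟩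
  by_contra hg
  obtain ⟨s, hs⟩ := Nat.exists_eq_add_of_le (show L ≤ w.length by omega)
  have h1 := H.pow_mul_norm_prod_le hL s w i hr hs hg
  have h2 := H.half_le_norm_prod_of_not_good (hL w i hr (by omega) hg) hg
  have h3 : ‖∏ k, x (w.drop s) k‖ ≤ M :=
    hM ⟨w.drop s, by simp [hs], rfl⟩
  have h4 : (K / 2) ^ t ≤ (K / 2) ^ s := pow_le_pow_right₀ (by linarith) (by omega)
  have h5 : 0 ≤ (K / 2) ^ s := pow_nonneg (by linarith) _
  nlinarith

end IsBowditchWordMap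

/-! ### Rays in alternating geodesics -/

/-- The colour of the `m`-th edge of an alternating ray. -/
def rayColour {n : ℕ} (a b : Fin n) (m : ℕ) : Fin n := if Even m then a else b

/-- The `m`-th vertex of the ray with colours `a, b, a, b, …` starting at `g`. -/
def ray {n : ℕ} (a b : Fin n) (g : List (Fin n)) : ℕ → List (Fin n)
  | 0 => g
  | m + 1 => rayColour a b m :: ray a b g m

theorem rayColour_add_two {n : ℕ} (a b : Fin n) (m : ℕ) :
    rayColour a b (m + 2) = rayColour a b m := by
  simp [rayColour, Nat.even_add]

theorem rayColour_cases {n : ℕ} (a b : Fin n) (m : ℕ) :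
    (rayColour a b m = a ∧ rayColour a b (m + 1) = b) ∨
      (rayColour a b m = b ∧ rayColour a b (m + 1) = a) := by
  by_cases h : Even m <;> simp [rayColour, h, Nat.even_add_one]

theorem rayColour_ne {n : ℕ} {a b : Fin n} (hab : a ≠ b) (m : ℕ) :
    rayColour a b m ≠ rayColour a b (m + 1) := by
  rcases rayColour_cases a b m with ⟨h1, h2⟩ | ⟨h1, h2⟩
  · rwa [h1, h2]
  · rw [h1, h2]; exact hab.symm

theorem length_ray {n : ℕ} (a b : Fin n) (g : List (Fin n)) (m : ℕ) :
    (ray a b g m).length = g.length + m := by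
  induction m with
  | zero => rfl
  | succ m ih => rw [ray, List.length_cons, ih, add_assoc]

theorem isReduced_ray_succ {n : ℕ} {a b : Fin n} {g : List (Fin n)} (hab : a ≠ b)
    (hg : IsReduced g) (ha : a ∈ freeColours g) (m : ℕ) : IsReduced (ray a b g (m + 1)) := by
  induction m with
  | zero => exact isReduced_cons.2 ⟨by simpa [rayColour, ray] using ha, hg⟩
  | succ m ih =>
    refine isReduced_cons.2 ⟨?_, ih⟩
    rw [ray, freeColours_cons]
    simpa using (rayColour_ne hab m).symm

/-- Strip the letters `i, j` from the top of `w`: what remains is the gate `g` of the geodesic, and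
the stripped letters alternate because `w` is reduced. -/
theorem exists_eq_ray {n : ℕ} {i j : Fin n} {w : List (Fin n)} (hw : IsReduced w) :
    ∃ a b g m, ((a = i ∧ b = j) ∨ (a = j ∧ b = i)) ∧ w = ray a b g m ∧ IsReduced g ∧
      a ∈ freeColours g ∧ b ∈ freeColours g := by
  induction w with
  | nil => exact ⟨i, j, [], 0, Or.inl ⟨rfl, rfl⟩, rfl, hw, by simp, by simp⟩
  | cons l w ih =>
    by_cases hl : l = i ∨ l = j
    · obtain ⟨hlw, hw⟩ := isReduced_cons.1 hw
      obtain ⟨a, b, g, m, hab, rfl, hg, ha, hb⟩ := ih hw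
      cases m with
      | zero =>
        have hl' : l = a ∨ l = b := by rcases hab with ⟨rfl, rfl⟩ | ⟨rfl, rfl⟩ <;> tauto
        rcases hl' with rfl | rfl
        · exact ⟨l, b, g, 1, hab, by simp [ray, rayColour], hg, ha, hb⟩
        · exact ⟨l, a, g, 1, by tauto, by simp [ray, rayColour], hg, hb, ha⟩
      | succ m =>
        refine ⟨a, b, g, m + 2, hab, ?_, hg, ha, hb⟩
        change l :: ray a b g (m + 1) = rayColour a b (m + 1) :: ray a b g (m + 1)
        congr 1
        have hne : l ≠ rayColour a b m := by
          rw [ray, freeColours_cons] at hlw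
          simpa using hlw
        rcases rayColour_cases a b m with ⟨h1, h2⟩ | ⟨h1, h2⟩ <;> rw [h1] at hne <;> rw [h2] <;>
          rcases hab with ⟨rfl, rfl⟩ | ⟨rfl, rfl⟩ <;> tauto
    · push Not at hl
      exact ⟨i, j, l :: w, 0, Or.inl ⟨rfl, rfl⟩, rfl, hw, by simpa using hl.1.symm,
        by simpa using hl.2.symm⟩

namespace IsBowditchWordMap

variable {n : ℕ} {μ : ℂ} {K : ℝ} {R : ℕ} {x : List (Fin n) → Fin n → ℂ}

theorem geo_ray (H : IsBowditchWordMap μ K R x) (a b : Fin n) (g : List (Fin n)) (m : ℕ) :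
    geo x (ray a b g m) a b = geo x g a b := by
  induction m with
  | zero => rfl
  | succ m ih =>
    rw [← ih, ray]
    rcases rayColour_cases a b m with ⟨h, -⟩ | ⟨h, -⟩ <;> rw [h]
    · exact H.geo_cons _ _ _
    · rw [geo_comm, H.geo_cons, geo_comm]

theorem geo_ray_rayColour (H : IsBowditchWordMap μ K R x) (a b : Fin n) (g : List (Fin n))
    (m : ℕ) : geo x (ray a b g m) (rayColour a b m) (rayColour a b (m + 1)) = geo x g a b := by
  rw [← H.geo_ray a b g m]
  rcases rayColour_cases a b m with ⟨h1, h2⟩ | ⟨h1, h2⟩ <;> rw [h1, h2]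
  exact geo_comm _ _ _ _

theorem eventually_expanding_ray (H : IsBowditchWordMap μ K R x) {a b : Fin n}
    {g : List (Fin n)} (hab : a ≠ b) (hg : IsReduced g) (ha : a ∈ freeColours g) :
    ∀ᶠ κ : ℝ in 𝓝[>] 0, ∀ᶠ m in atTop, Expanding κ (geo x g a b)
      (x (ray a b g m) (rayColour a b (m + 1)))
      (x (rayColour a b m :: ray a b g m) (rayColour a b m)) := by
  obtain ⟨k, hka, hkb⟩ := exists_ne_ne H.three_le a b
  have hkc : ∀ m, k ≠ rayColour a b m := fun m => by
    unfold rayColour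
    split_ifs <;> assumption
  have hxk : ∀ m, x (ray a b g m) k = x g k := by
    intro m
    induction m with
    | zero => rfl
    | succ m ih => rw [ray, H.cons_ne _ (hkc m), ih]
  have hz := H.geo_ne_zero g hab
  have hK := H.two_lt
  have hy := eventually_expanding (H.notMem g hab)
    (y := fun m => x (ray a b g m) (rayColour a b (m + 1)))
    (ε := K * ‖x g k‖ / ‖geo x g a b‖) ?_ ?_ ?_
  · simpa only [rayColour_add_two, ray] using hy
  · intro m
    have h1 := H.edge (ray a b g (m + 1)) (rayColour a b (m + 1))
    have h2 := H.cons_ne (ray a b g m) (rayColour_ne hab m).symm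
    have h3 := H.edgeProd_cons_ne (ray a b g m) (rayColour_ne hab m)
    rw [H.geo_ray_rayColour] at h3
    simp only [ray, rayColour_add_two] at h1 ⊢
    rw [h2, h3] at h1
    linear_combination h1
  · have := norm_pos_iff.2 (H.ne_zero g k)
    have := norm_pos_iff.2 hz
    positivity
  · filter_upwards [eventually_ge_atTop (R + 1)] with m hm
    obtain ⟨m, rfl⟩ : ∃ m', m = m' + 1 := ⟨m - 1, by omega⟩
    have hred := isReduced_ray_succ hab hg ha (m + 1)
    rw [ray] at hred
    obtain ⟨h1, h2⟩ := isReduced_cons.1 hred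
    have hlen := length_ray a b g (m + 1)
    -- The third colour `k` is free at every later vertex of the ray, so a large geodesic with
    -- colour `k` is born there. As `x_k` is constant along the ray, this bounds `‖y m‖` from below.
    have h3 := H.large h2 (by omega) h1 (j := k)
      (by rw [ray, freeColours_cons]; simpa using hkc m) (hkc _).symm
    have h4 := (mul_geo x (ray a b g (m + 1)) (hkc (m + 1)).symm).trans
      (mul_geo x (ray a b g (m + 1)) (rayColour_ne hab (m + 1))).symm
    rw [H.geo_ray_rayColour, hxk] at h4
    have h5 := congrArg norm h4
    rw [norm_mul, norm_mul] at h5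
    rw [div_le_iff₀ (norm_pos_iff.2 hz), ← h5, mul_comm]
    exact mul_le_mul_of_nonneg_left h3.le (norm_nonneg _)

/-- A geodesic that is not large has its gate at depth less than `R`. So only finitely many rays
matter, and they have a common `κ` and a common threshold. -/
theorem exists_expanding (H : IsBowditchWordMap μ K R x) :
    ∃ κ : ℝ, 0 < κ ∧ ∃ L : ℕ, ∀ w i, IsReduced (i :: w) → L ≤ w.length → ∀ j, j ≠ i →
      K < ‖geo x w i j‖ ∨ Expanding κ (geo x w i j) (x w j) (x (i :: w) i) := by
  have hfin : ({g : List (Fin n) | g.length < R} ×ˢ (Set.univ : Set (Fin n × Fin n))).Finite :=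
    (List.finite_length_lt _ _).prod Set.finite_univ
  have h1 : ∀ᶠ κ : ℝ in 𝓝[>] 0, ∀ p ∈ {g : List (Fin n) | g.length < R} ×ˢ
      (Set.univ : Set (Fin n × Fin n)), p.2.1 ≠ p.2.2 → IsReduced p.1 → p.2.1 ∈ freeColours p.1 →
      ∀ᶠ m in atTop, Expanding κ (geo x p.1 p.2.1 p.2.2)
      (x (ray p.2.1 p.2.2 p.1 m) (rayColour p.2.1 p.2.2 (m + 1)))
      (x (rayColour p.2.1 p.2.2 m :: ray p.2.1 p.2.2 p.1 m) (rayColour p.2.1 p.2.2 m)) := by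
    rw [eventually_all_finite hfin]
    intro p _
    by_cases hp : p.2.1 ≠ p.2.2 ∧ IsReduced p.1 ∧ p.2.1 ∈ freeColours p.1
    · filter_upwards [H.eventually_expanding_ray hp.1 hp.2.1 hp.2.2] with κ hκ _ _ _ using hκ
    · filter_upwards with κ a b c using absurd ⟨a, b, c⟩ hp
  obtain ⟨κ, hκ, hκ0⟩ := (h1.and self_mem_nhdsWithin).exists
  have h2 : ∀ᶠ m in atTop, ∀ p ∈ {g : List (Fin n) | g.length < R} ×ˢ
      (Set.univ : Set (Fin n × Fin n)), p.2.1 ≠ p.2.2 → IsReduced p.1 → p.2.1 ∈ freeColours p.1 →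
      Expanding κ (geo x p.1 p.2.1 p.2.2)
      (x (ray p.2.1 p.2.2 p.1 m) (rayColour p.2.1 p.2.2 (m + 1)))
      (x (rayColour p.2.1 p.2.2 m :: ray p.2.1 p.2.2 p.1 m) (rayColour p.2.1 p.2.2 m)) := by
    rw [eventually_all_finite hfin]
    intro p hp
    by_cases hp' : p.2.1 ≠ p.2.2 ∧ IsReduced p.1 ∧ p.2.1 ∈ freeColours p.1
    · filter_upwards [hκ p hp hp'.1 hp'.2.1 hp'.2.2] with m hm _ _ _ using hm
    · filter_upwards with κ a b c using absurd ⟨a, b, c⟩ hp'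
  obtain ⟨m₀, hm₀⟩ := eventually_atTop.1 h2
  refine ⟨κ, hκ0, R + m₀ + 1, fun w i hr hl j hj => ?_⟩
  obtain ⟨hi, hw⟩ := isReduced_cons.1 hr
  by_cases hz : K < ‖geo x w i j‖
  · exact Or.inl hz
  right
  obtain ⟨a, b, g, m, hab, rfl, hg, ha, hb⟩ := exists_eq_ray (i := i) (j := j) hw
  have hab' : a ≠ b := by
    rcases hab with ⟨rfl, rfl⟩ | ⟨rfl, rfl⟩
    · exact hj.symm
    · exact hj
  have hgeo : geo x g a b = geo x (ray a b g m) i j := by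
    rw [← H.geo_ray a b g m]
    rcases hab with ⟨rfl, rfl⟩ | ⟨rfl, rfl⟩
    · rfl
    · exact geo_comm _ _ _ _
  have hgR : g.length < R := by
    by_contra! h
    exact hz (hgeo ▸ H.large hg h ha hb hab')
  rw [length_ray] at hl
  obtain ⟨m, rfl⟩ : ∃ m', m = m' + 1 := ⟨m - 1, by omega⟩
  have key := hm₀ (m + 1) (by omega) (g, a, b) ⟨hgR, trivial⟩ hab' hg ha
  -- Since `w` has already left the gate, reducedness makes `i` the next colour of the ray.
  have hne : i ≠ rayColour a b m := by
    rw [ray, freeColours_cons] at hi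
    simpa using hi
  have hcol : rayColour a b (m + 1) = i ∧ rayColour a b (m + 1 + 1) = j := by
    rw [show m + 1 + 1 = m + 2 from rfl, rayColour_add_two]
    rcases rayColour_cases a b m with ⟨h1, h2⟩ | ⟨h1, h2⟩ <;> rw [h1] at hne <;> rw [h1, h2] <;>
      rcases hab with ⟨rfl, rfl⟩ | ⟨rfl, rfl⟩ <;> tauto
  simp only [hcol.1, hcol.2, hgeo] at key
  exact key

theorem exists_growth (H : IsBowditchWordMap μ K R x) :
    ∃ κ : ℝ, 0 < κ ∧ ∃ L : ℕ, R ≤ L ∧ ∀ w i, IsReduced (i :: w) → L ≤ w.length → Good x w i ∧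
      ∀ j, j ≠ i → K < ‖geo x w i j‖ ∨ Expanding κ (geo x w i j) (x w j) (x (i :: w) i) := by
  obtain ⟨κ, hκ, L, hL⟩ := H.exists_expanding
  -- An expanding geodesic makes its edge good, so all geodesics through a bad edge are large.
  obtain ⟨L', hLL', hL'⟩ := H.exists_forall_good (L := L) fun w i hr hl hg j hj =>
    (hL w i hr hl j hj).resolve_right fun he => hg (by
      have := he.half
      rwa [mul_comm (geo x w i j), mul_geo x w hj.symm] at this)
  exact ⟨κ, hκ, max R L', le_max_left _ _, fun w i hr hl =>
    ⟨hL' w i hr (le_trans (le_max_right _ _) hl),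
      hL w i hr (hLL'.trans (le_trans (le_max_right _ _) hl))⟩⟩

end IsBowditchWordMap

/-! ### Sums over pairs -/

/-- The sum of `f j * f k` over the ordered pairs of distinct elements of `s`. -/
def pairSum {ι : Type*} [DecidableEq ι] (s : Finset ι) (f : ι → ℝ) : ℝ :=
  ∑ j ∈ s, f j * ∑ k ∈ s.erase j, f k

section pairSum

variable {ι : Type*} [DecidableEq ι] {s : Finset ι} {f g : ι → ℝ}

theorem pairSum_nonneg (hf : ∀ j ∈ s, 0 ≤ f j) : 0 ≤ pairSum s f :=
  Finset.sum_nonneg fun j hj => mul_nonneg (hf j hj)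
    (Finset.sum_nonneg fun k hk => hf k (Finset.mem_of_mem_erase hk))

theorem mul_le_pairSum (hf : ∀ j ∈ s, 0 ≤ f j) {j k : ι} (hj : j ∈ s) (hk : k ∈ s)
    (hjk : j ≠ k) : f j * f k ≤ pairSum s f := by
  have hk' : k ∈ s.erase j := by simp [hk, hjk.symm]
  calc f j * f k ≤ f j * ∑ k ∈ s.erase j, f k :=
        mul_le_mul_of_nonneg_left (Finset.single_le_sum
          (fun l hl => hf l (Finset.mem_of_mem_erase hl)) hk') (hf j hj)
    _ ≤ _ := Finset.single_le_sum (f := fun j => f j * ∑ k ∈ s.erase j, f k)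
        (fun l hl => mul_nonneg (hf l hl)
          (Finset.sum_nonneg fun k hk => hf k (Finset.mem_of_mem_erase hk))) hj

theorem two_mul_le_pairSum (hf : ∀ j ∈ s, 0 ≤ f j) {j : ι} (hj : j ∈ s) :
    2 * (f j * ∑ k ∈ s.erase j, f k) ≤ pairSum s f := by
  rw [pairSum, ← Finset.add_sum_erase _ _ hj, two_mul]
  refine add_le_add_right ?_ _
  rw [Finset.mul_sum]
  refine Finset.sum_le_sum fun k hk => ?_
  rw [mul_comm]
  refine mul_le_mul_of_nonneg_left ?_ (hf k (Finset.mem_of_mem_erase hk))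
  exact Finset.single_le_sum (fun l hl => hf l (Finset.mem_of_mem_erase hl))
    (by simp [hj, (Finset.ne_of_mem_erase hk).symm])

/-- Crossing from one edge to its successor of colour `j`, the old geodesic `{i, j}` keeps its
weight `f j` and the newborn ones have total `T ≤ f j * t`. The new pair sum is at most `2 f j T +
T²`. -/
theorem pairSum_insert_erase_le {i j : ι} (hi : i ∉ s) (hf : ∀ k ∈ s, 0 ≤ f k) (hj : j ∈ s)
    (hgi : g i = f j) (hg0 : ∀ k ∈ s.erase j, 0 ≤ g k) (hg : ∀ k ∈ s.erase j, g k ≤ f j * f k) :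
    pairSum (insert i (s.erase j)) g ≤
      (f j * ∑ k ∈ s.erase j, f k) * (f j * (2 + ∑ k ∈ s.erase j, f k)) := by
  have hi' : i ∉ s.erase j := fun h => hi (Finset.mem_of_mem_erase h)
  set s' := s.erase j with hs'
  set t := ∑ k ∈ s', f k
  set T := ∑ k ∈ s', g k with hT
  have hT0 : 0 ≤ T := Finset.sum_nonneg hg0
  have hTt : T ≤ f j * t := by
    rw [Finset.mul_sum]
    exact Finset.sum_le_sum hg
  have hfj := hf j hj
  have h1 : pairSum (insert i s') g ≤ f j * T + T * (f j + T) := by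
    rw [pairSum, Finset.sum_insert hi', Finset.erase_insert hi', hgi, Finset.sum_mul]
    refine add_le_add_right (Finset.sum_le_sum fun k hk => ?_) _
    refine mul_le_mul_of_nonneg_left ?_ (hg0 k hk)
    have hik : i ≠ k := fun h => hi' (h ▸ hk)
    rw [Finset.erase_insert_of_ne hik, Finset.sum_insert
      (fun h => hi' (Finset.mem_of_mem_erase h)), hgi]
    refine add_le_add_right ?_ _
    exact Finset.sum_le_sum_of_subset_of_nonneg (Finset.erase_subset _ _) fun l hl _ => hg0 l hl
  nlinarith [mul_le_mul_of_nonneg_left hTt hfj, mul_le_mul hTt hTt hT0 (hT0.trans hTt)]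

/-- The successor along the dominant `j₀` gains a factor of about `2 f j₀`, but its pairs make up at
most half of `pairSum`, which leaves `τ`. Every other successor contributes `O(ε)`. -/
theorem sum_pair_growth_le {τ ε : ℝ} (hτ1 : τ ≤ 1) (hε0 : 0 ≤ ε)
    (hf : ∀ j ∈ s, 0 ≤ f j) (hfτ : ∀ j ∈ s, f j ≤ τ) {j₀ : ι} (hj₀ : j₀ ∈ s)
    (hfε : ∀ j ∈ s, j ≠ j₀ → f j ≤ ε) :
    ∑ j ∈ s, (f j * ∑ k ∈ s.erase j, f k) * (f j * (2 + ∑ k ∈ s.erase j, f k)) ≤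
      (τ + ε * (2 + 2 * s.card)) * pairSum s f := by
  have hτ0 : 0 ≤ τ := (hf j₀ hj₀).trans (hfτ j₀ hj₀)
  have ht0 : ∀ j, 0 ≤ ∑ k ∈ s.erase j, f k := fun j =>
    Finset.sum_nonneg fun k hk => hf k (Finset.mem_of_mem_erase hk)
  have hcard : ∀ j, ((s.erase j).card : ℝ) ≤ s.card := fun j => by
    exact_mod_cast Finset.card_le_card (Finset.erase_subset _ _)
  have ht1 : ∀ j, ∑ k ∈ s.erase j, f k ≤ s.card := fun j => by
    refine (Finset.sum_le_card_nsmul _ _ 1 fun k hk =>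
      (hfτ k (Finset.mem_of_mem_erase hk)).trans hτ1).trans ?_
    rw [nsmul_eq_mul, mul_one]
    exact hcard j
  have htε : ∑ k ∈ s.erase j₀, f k ≤ s.card * ε := by
    refine (Finset.sum_le_card_nsmul _ _ ε fun k hk =>
      hfε k (Finset.mem_of_mem_erase hk) (Finset.ne_of_mem_erase hk)).trans ?_
    rw [nsmul_eq_mul]
    exact mul_le_mul_of_nonneg_right (hcard j₀) hε0
  have hE := pairSum_nonneg hf
  rw [← Finset.add_sum_erase _ _ hj₀]
  have h1 : (f j₀ * ∑ k ∈ s.erase j₀, f k) * (f j₀ * (2 + ∑ k ∈ s.erase j₀, f k)) ≤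
      (τ + ε * s.card) * pairSum s f := by
    have e1 := two_mul_le_pairSum hf hj₀
    have e2 : f j₀ * (2 + ∑ k ∈ s.erase j₀, f k) ≤ 2 * (τ + ε * s.card) := by
      have : f j₀ * (2 + ∑ k ∈ s.erase j₀, f k) ≤ τ * (2 + s.card * ε) :=
        mul_le_mul (hfτ j₀ hj₀) (by linarith) (by linarith [ht0 j₀]) hτ0
      nlinarith [mul_nonneg (Nat.cast_nonneg (α := ℝ) s.card) hε0]
    have e3 := mul_nonneg (hf j₀ hj₀) (ht0 j₀)
    have e4 : 0 ≤ τ + ε * s.card := by positivity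
    nlinarith [mul_le_mul_of_nonneg_left e2 e3, mul_le_mul_of_nonneg_right e1 e4]
  have h2 : ∑ j ∈ s.erase j₀, (f j * ∑ k ∈ s.erase j, f k) *
      (f j * (2 + ∑ k ∈ s.erase j, f k)) ≤ ε * (2 + s.card) * pairSum s f := by
    have e1 : ∑ j ∈ s.erase j₀, f j * ∑ k ∈ s.erase j, f k ≤ pairSum s f :=
      Finset.sum_le_sum_of_subset_of_nonneg (Finset.erase_subset _ _)
        fun j hj _ => mul_nonneg (hf j hj) (ht0 j)
    refine le_trans (Finset.sum_le_sum (g := fun j => (f j * ∑ k ∈ s.erase j, f k) *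
      (ε * (2 + s.card))) fun j hj => ?_) ?_
    · have hjs := Finset.mem_of_mem_erase hj
      refine mul_le_mul_of_nonneg_left ?_ (mul_nonneg (hf j hjs) (ht0 j))
      exact mul_le_mul (hfε j hjs (Finset.ne_of_mem_erase hj)) (by linarith [ht1 j])
        (by linarith [ht0 j]) hε0
    · rw [← Finset.sum_mul, mul_comm]
      exact mul_le_mul_of_nonneg_left e1 (by positivity)
  calc _ ≤ (τ + ε * s.card) * pairSum s f + ε * (2 + s.card) * pairSum s f := add_le_add h1 h2
    _ = _ := by ring

end pairSum

/-! ### Submultiplicative weights on edges -/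

/-- Weights `a w i j` of the geodesics with colours `i`, `j` through the edges `w → i :: w` that
are submultiplicative away from the root. -/
structure IsWeight {n : ℕ} (τ : ℝ) (L : ℕ) (a : List (Fin n) → Fin n → Fin n → ℝ) : Prop where
  pos : 0 < τ
  lt_one : τ < 1
  nonneg : ∀ {w i}, IsReduced (i :: w) → L ≤ w.length → ∀ {j}, j ≠ i → 0 ≤ a w i j
  le : ∀ {w i}, IsReduced (i :: w) → L ≤ w.length → ∀ {j}, j ≠ i → a w i j ≤ τ
  back : ∀ {w i}, IsReduced (i :: w) → L ≤ w.length → ∀ {j}, j ≠ i → a (i :: w) j i = a w i j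
  step : ∀ {w i}, IsReduced (i :: w) → L ≤ w.length → ∀ {j k}, j ≠ i → k ≠ i → j ≠ k →
    a (i :: w) j k ≤ a w i j * a w i k

namespace IsWeight

variable {n : ℕ} {τ : ℝ} {L : ℕ} {a : List (Fin n) → Fin n → Fin n → ℝ}

/-- The exception is the colour `l` just used. Any other weight is at most a product of two earlier
weights, of which at most one is exceptional; so each level gains a factor `τ`. -/
theorem exists_le_pow (ha : IsWeight τ L a) (hn : 3 ≤ n) (N : ℕ) :
    ∀ w i, IsReduced (i :: w) → L + N ≤ w.length →
      ∃ j₀, j₀ ≠ i ∧ ∀ j, j ≠ i → j ≠ j₀ → a w i j ≤ τ ^ (N + 1) := by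
  induction N with
  | zero =>
    intro w i hr hl
    obtain ⟨j, hj, -⟩ := exists_ne_ne hn i i
    exact ⟨j, hj, fun j hj _ => by simpa using ha.le hr hl hj⟩
  | succ N ih =>
    intro w i hr hl
    obtain ⟨l, w, rfl⟩ : ∃ l w', w = l :: w' := List.exists_cons_of_ne_nil (by
      rintro rfl
      simp at hl)
    rw [List.length_cons] at hl
    obtain ⟨hi, hw⟩ := isReduced_cons.1 hr
    have hil : i ≠ l := by simpa using hi
    obtain ⟨j₀, -, hj₀⟩ := ih w l hw (by omega)
    refine ⟨l, hil.symm, fun k hki hkl => ?_⟩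
    refine (ha.step hw (by omega) hil hkl hki.symm).trans ?_
    have p := pow_nonneg ha.pos.le (N + 1)
    by_cases h : k = j₀
    · have := hj₀ i hil (fun h' => hki (h.trans h'.symm))
      calc a w l i * a w l k ≤ τ ^ (N + 1) * τ :=
            mul_le_mul this (ha.le hw (by omega) hkl) (ha.nonneg hw (by omega) hkl) p
        _ = _ := by ring
    · calc a w l i * a w l k ≤ τ * τ ^ (N + 1) :=
            mul_le_mul (ha.le hw (by omega) hil) (hj₀ k hkl h) (ha.nonneg hw (by omega) hkl)
              ha.pos.le
        _ = _ := by ring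

theorem exists_forall_le (ha : IsWeight τ L a) (hn : 3 ≤ n) {ε : ℝ} (hε : 0 < ε) :
    ∃ L', L ≤ L' ∧ ∀ w i, IsReduced (i :: w) → L' ≤ w.length →
      ∃ j₀, j₀ ≠ i ∧ ∀ j, j ≠ i → j ≠ j₀ → a w i j ≤ ε := by
  obtain ⟨N, hN⟩ := exists_pow_lt_of_lt_one hε ha.lt_one
  refine ⟨L + N, by omega, fun w i hr hl => ?_⟩
  obtain ⟨j₀, hj₀, h⟩ := ha.exists_le_pow hn N w i hr hl
  refine ⟨j₀, hj₀, fun j hj hjj => (h j hj hjj).trans ?_⟩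
  exact (pow_le_pow_of_le_one ha.pos.le ha.lt_one.le (Nat.le_succ N)).trans hN.le

/-- The total pair weight of an edge. -/
def edgeWeight {n : ℕ} (a : List (Fin n) → Fin n → Fin n → ℝ) (w : List (Fin n)) (i : Fin n) : ℝ :=
  pairSum (Finset.univ.erase i) (a w i)

theorem edgeWeight_nonneg (ha : IsWeight τ L a) {w : List (Fin n)} {i : Fin n}
    (hr : IsReduced (i :: w)) (hl : L ≤ w.length) : 0 ≤ edgeWeight a w i :=
  pairSum_nonneg fun _ hj => ha.nonneg hr hl (Finset.ne_of_mem_erase hj)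

theorem mul_le_edgeWeight (ha : IsWeight τ L a) {w : List (Fin n)} {i j k : Fin n}
    (hr : IsReduced (i :: w)) (hl : L ≤ w.length) (hj : j ≠ i) (hk : k ≠ i) (hjk : j ≠ k) :
    a w i j * a w i k ≤ edgeWeight a w i :=
  mul_le_pairSum (fun _ hj => ha.nonneg hr hl (Finset.ne_of_mem_erase hj))
    (by simpa using hj) (by simpa using hk) hjk

theorem exists_sum_edgeWeight_le (ha : IsWeight τ L a) (hn : 3 ≤ n) :
    ∃ ρ, 0 < ρ ∧ ρ < 1 ∧ ∃ L', L ≤ L' ∧ ∀ w i, IsReduced (i :: w) → L' ≤ w.length →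
      ∑ j ∈ freeColours (i :: w), edgeWeight a (i :: w) j ≤ ρ * edgeWeight a w i := by
  have hc : (0:ℝ) < 2 * (2 + 2 * n) := by positivity
  have hτ := ha.lt_one
  have hτ0 := ha.pos
  -- Chosen so that `τ + ε (2 + 2n) = (1 + τ) / 2`, which serves as `ρ`.
  set ε := (1 - τ) / (2 * (2 + 2 * n)) with hεdef
  have hε : 0 < ε := div_pos (by linarith) hc
  obtain ⟨L', hLL', hL'⟩ := ha.exists_forall_le hn hε
  refine ⟨(1 + τ) / 2, by linarith, by linarith, L', hLL', fun w i hr hl => ?_⟩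
  obtain ⟨j₀, hj₀, hj₀'⟩ := hL' w i hr hl
  have hl' := hLL'.trans hl
  have hnn : ∀ j ∈ Finset.univ.erase i, 0 ≤ a w i j := fun j hj =>
    ha.nonneg hr hl' (Finset.ne_of_mem_erase hj)
  rw [freeColours_cons]
  refine (Finset.sum_le_sum fun j hj => ?_).trans ((sum_pair_growth_le (s := Finset.univ.erase i)
    (f := a w i) (j₀ := j₀) hτ.le hε.le hnn
    (fun j hj => ha.le hr hl' (Finset.ne_of_mem_erase hj)) (by simpa using hj₀)
    (fun j hj => hj₀' j (Finset.ne_of_mem_erase hj))).trans ?_)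
  · have hji := Finset.ne_of_mem_erase hj
    have hr' : IsReduced (j :: i :: w) := isReduced_cons.2 ⟨by simpa using hji, hr⟩
    have hset : (Finset.univ.erase j : Finset (Fin n)) = insert i ((Finset.univ.erase i).erase j) := by
      ext k
      simp only [Finset.mem_erase, Finset.mem_univ, and_true, Finset.mem_insert]
      by_cases hk : k = i
      · simp [hk, hji.symm]
      · simp [hk]
    rw [edgeWeight, hset]
    refine pairSum_insert_erase_le (by simp) hnn hj (ha.back hr hl' hji) ?_ ?_
    · intro k hk
      exact ha.nonneg hr' (by simp; omega) (Finset.ne_of_mem_erase hk)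
    · intro k hk
      simp only [Finset.mem_erase, Finset.mem_univ, and_true] at hk
      exact ha.step hr hl' hji hk.2 hk.1.symm
  · refine mul_le_mul_of_nonneg_right ?_ (ha.edgeWeight_nonneg hr hl')
    have h1 : ((Finset.univ.erase i).card : ℝ) ≤ n := by
      have := Finset.card_le_univ (Finset.univ.erase i)
      rw [Fintype.card_fin] at this
      exact_mod_cast this
    have h2 : ε * (2 * (2 + 2 * n)) = 1 - τ := div_mul_cancel₀ _ hc.ne'
    nlinarith

theorem exists_level_sum_le (ha : IsWeight τ L a) (hn : 3 ≤ n) :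
    ∃ ρ, 0 < ρ ∧ ρ < 1 ∧ ∃ C L', L ≤ L' ∧ ∀ t,
      ∑ w ∈ level n (L' + t), ∑ i ∈ freeColours w, edgeWeight a w i ≤ C * ρ ^ t := by
  obtain ⟨ρ, h0, h1, L', hL, h⟩ := ha.exists_sum_edgeWeight_le hn
  refine ⟨ρ, h0, h1, ∑ w ∈ level n L', ∑ i ∈ freeColours w, edgeWeight a w i, L', hL, fun t => ?_⟩
  induction t with
  | zero => simp
  | succ t ih =>
    have : ∑ w ∈ level n (L' + (t + 1)), ∑ i ∈ freeColours w, edgeWeight a w i ≤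
        ρ * ∑ w ∈ level n (L' + t), ∑ i ∈ freeColours w, edgeWeight a w i := by
      rw [← add_assoc, sum_level_succ (fun w => ∑ i ∈ freeColours w, edgeWeight a w i),
        Finset.mul_sum]
      refine Finset.sum_le_sum fun w hw => ?_
      rw [Finset.mul_sum]
      refine Finset.sum_le_sum fun i hi => ?_
      obtain ⟨hr, hl⟩ := mem_level.1 hw
      exact h w i (isReduced_cons.2 ⟨hi, hr⟩) (by omega)
    refine this.trans ((mul_le_mul_of_nonneg_left ih h0.le).trans (le_of_eq ?_))
    ring

end IsWeight

/-! ### The weights of a Hurwitz map -/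

/-- The weight `2 / |φ(γ)|` of a large geodesic, and the constant `τ` for the others. -/
def geoWeight {n : ℕ} (K τ : ℝ) (x : List (Fin n) → Fin n → ℂ) (w : List (Fin n))
    (i j : Fin n) : ℝ :=
  open Classical in if K < ‖geo x w i j‖ then 2 / ‖geo x w i j‖ else τ

namespace IsBowditchWordMap

variable {n : ℕ} {μ : ℂ} {K : ℝ} {R : ℕ} {x : List (Fin n) → Fin n → ℂ}

/-- If both parents are large, goodness gives `|z_{jk}| ≥ |z_{ij}| |z_{ik}| / 2`; the `2` in the
weight absorbs the loss. A small parent contributes its growth factor `1 + κ` instead. -/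
theorem geoWeight_step (H : IsBowditchWordMap μ K R x) {κ τ : ℝ} (hκ : 0 < κ)
    (hτκ : 1 / (1 + κ) ≤ τ) {w : List (Fin n)} {i : Fin n}
    (hr : IsReduced (i :: w)) (hl : R ≤ w.length) (hg : Good x w i)
    (hx : ∀ j, j ≠ i → K < ‖geo x w i j‖ ∨ Expanding κ (geo x w i j) (x w j) (x (i :: w) i))
    {j k : Fin n} (hj : j ≠ i) (hk : k ≠ i) (hjk : j ≠ k) :
    geoWeight K τ x (i :: w) j k ≤ geoWeight K τ x w i j * geoWeight K τ x w i k := by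
  have hK := H.two_lt
  obtain ⟨hi, hw⟩ := isReduced_cons.1 hr
  have hnew : K < ‖geo x (i :: w) j k‖ := H.large hr (by simp; omega)
    (by simpa using hj) (by simpa using hk) hjk
  have main : ∀ j k, j ≠ i → k ≠ i → j ≠ k → ¬ K < ‖geo x w i j‖ → K < ‖geo x w i k‖ →
      2 / ‖geo x (i :: w) j k‖ ≤ τ * (2 / ‖geo x w i k‖) := by
    intro j k hj hk hjk h1 h2
    have h3 := ((hx j hj).resolve_left h1).one_add
    have h4 := congrArg norm (H.geo_cons_mul w hj.symm hk.symm hjk)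
    rw [norm_mul, norm_mul] at h4
    have hxj := norm_pos_iff.2 (H.ne_zero w j)
    have hz : 0 < ‖geo x w i k‖ := by linarith
    have h5 : (1 + κ) * ‖geo x w i k‖ ≤ ‖geo x (i :: w) j k‖ := by
      refine le_of_mul_le_mul_right ?_ hxj
      rw [h4]
      nlinarith
    calc 2 / ‖geo x (i :: w) j k‖ ≤ 2 / ((1 + κ) * ‖geo x w i k‖) := by gcongr
      _ = 1 / (1 + κ) * (2 / ‖geo x w i k‖) := by field_simp
      _ ≤ _ := by gcongr
  rw [geoWeight, if_pos hnew, geoWeight, geoWeight]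
  by_cases h1 : K < ‖geo x w i j‖ <;> by_cases h2 : K < ‖geo x w i k‖
  · rw [if_pos h1, if_pos h2]
    have h4 := congrArg norm (H.geo_cons_mul w hj.symm hk.symm hjk)
    rw [norm_mul, norm_mul] at h4
    rw [Good, ← mul_geo x w hj.symm, norm_mul] at hg
    have hxj := norm_pos_iff.2 (H.ne_zero w j)
    have hz1 : 0 < ‖geo x w i j‖ := by linarith
    have hz2 : 0 < ‖geo x w i k‖ := by linarith
    have h5 : ‖geo x w i j‖ * ‖geo x w i k‖ / 2 ≤ ‖geo x (i :: w) j k‖ := by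
      refine le_of_mul_le_mul_right ?_ hxj
      rw [h4]
      nlinarith
    calc 2 / ‖geo x (i :: w) j k‖ ≤ 2 / (‖geo x w i j‖ * ‖geo x w i k‖ / 2) := by gcongr
      _ = _ := by field_simp
  · rw [if_pos h1, if_neg h2, geo_comm, mul_comm]
    exact main k j hk hj hjk.symm h2 h1
  · rw [if_neg h1, if_pos h2]
    exact main j k hj hk hjk h1 h2
  -- A small geodesic through `w` cannot have its gate at `w`, so its other colour is the head of
  -- `w`; this cannot be both `j` and `k`.
  · exfalso
    obtain ⟨w₁, rfl⟩ := eq_cons_of_notMem_freeColours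
      (fun h => h1 (H.large hw hl hi h hj.symm))
    have : k ∉ freeColours (j :: w₁) := fun h => h2 (H.large hw hl hi h hk.symm)
    simp [hjk.symm] at this

/-- Estimates along all edges far from the root. -/
theorem exists_weight (H : IsBowditchWordMap μ K R x) :
    ∃ (a : List (Fin n) → Fin n → Fin n → ℝ) (τ C κ : ℝ) (L : ℕ), 0 < C ∧ 0 < κ ∧
      IsWeight τ L a ∧ ∀ w i, IsReduced (i :: w) → L ≤ w.length → Good x w i ∧
        ∀ j, j ≠ i → 1 ≤ C * a w i j * ‖geo x w i j‖ ∧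
          κ ≤ ‖x (i :: w) i / edgeProd x w i - eta (geo x w i j)‖ := by
  have hK := H.two_lt
  obtain ⟨κ, hκ, L, hRL, hL⟩ := H.exists_growth
  set τ := max (2 / K) (1 / (1 + κ)) with hτ
  have hτ0 : 0 < τ := lt_max_of_lt_left (by positivity)
  have hτ1 : τ < 1 := max_lt ((div_lt_one (by linarith)).2 hK)
    ((div_lt_one (by linarith)).2 (by linarith))
  have hKinv : 1 / K < 1 / 2 := one_div_lt_one_div_of_lt two_pos hK
  -- The constant `1 + 1 / (τ κ)` covers small geodesics, where the weight is `τ` and `|z| ≥ κ`. The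
  -- gap `1/2 - 1/K` covers large ones, where `|x_i' / P| ≥ 1/2` and `|η| ≤ 1/K`.
  refine ⟨geoWeight K τ x, τ, 1 + 1 / (τ * κ), min κ (1 / 2 - 1 / K), L, by positivity,
    lt_min hκ (by linarith), ⟨hτ0, hτ1, ?_, ?_, ?_, ?_⟩, fun w i hr hl => ⟨(hL w i hr hl).1, ?_⟩⟩
  · intro w i _ _ j _
    rw [geoWeight]
    split_ifs <;> positivity
  · intro w i _ _ j _
    rw [geoWeight]
    split_ifs with h
    · exact le_trans (by gcongr) (le_max_left _ _)
    · exact le_rfl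
  · intro w i _ _ j _
    rw [geoWeight, geoWeight, geo_comm, H.geo_cons]
  · intro w i hr hl j k hj hk hjk
    obtain ⟨hg, hx⟩ := hL w i hr hl
    exact H.geoWeight_step hκ (le_max_right _ _) hr (hRL.trans hl) hg hx hj hk hjk
  · intro j hj
    obtain ⟨hg, hx⟩ := hL w i hr hl
    have hz := H.geo_ne_zero w hj.symm
    have hz' := norm_pos_iff.2 hz
    have hpos : 0 < 1 / (τ * κ) := by positivity
    by_cases h : K < ‖geo x w i j‖
    · rw [geoWeight, if_pos h]
      constructor
      · rw [mul_assoc, div_mul_cancel₀ _ hz'.ne']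
        linarith
      · refine (min_le_right _ _).trans ?_
        have h1 : 1 / 2 ≤ ‖x (i :: w) i / edgeProd x w i‖ := by
          rw [norm_div, le_div_iff₀ (norm_pos_iff.2 (H.edgeProd_ne_zero w i))]
          exact hg
        have h2 : ‖eta (geo x w i j)‖ ≤ 1 / K := (norm_eta_le _).trans (by gcongr)
        have h3 := norm_sub_norm_le (x (i :: w) i / edgeProd x w i) (eta (geo x w i j))
        linarith
    · have he := (hx j hj).resolve_left h
      rw [geoWeight, if_neg h]
      constructor
      · have h1 : 1 / (τ * κ) * τ * κ = 1 := by field_simp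
        have h2 : 0 < (1 + 1 / (τ * κ)) * τ := by positivity
        nlinarith [mul_le_mul_of_nonneg_left he.le_norm h2.le, mul_pos hτ0 hκ]
      · refine (min_le_left _ _).trans ?_
        have := he.sep
        rwa [mul_comm (geo x w i j), mul_geo x w hj.symm] at this

end IsBowditchWordMap

open IsWeight

/-! ### Error estimates -/

/-- The contribution of the edge `w → i :: w` to the vertex relation at `w`. -/
def edgeRatio {n : ℕ} (x : List (Fin n) → Fin n → ℂ) (w : List (Fin n)) (i : Fin n) : ℂ :=
  x w i / edgeProd x w i

/-- The contribution of the ends of the geodesics through the edge `w → i :: w`. -/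
def edgeEta {n : ℕ} (x : List (Fin n) → Fin n → ℂ) (w : List (Fin n)) (i : Fin n) : ℂ :=
  ∑ j ∈ Finset.univ.erase i, eta (geo x w i j)

namespace IsBowditchWordMap

variable {n : ℕ} {μ : ℂ} {K : ℝ} {R : ℕ} {x : List (Fin n) → Fin n → ℂ}

theorem one_sub_edgeRatio (H : IsBowditchWordMap μ K R x) (w : List (Fin n)) (i : Fin n) :
    1 - edgeRatio x w i = x (i :: w) i / edgeProd x w i := by
  rw [edgeRatio, one_sub_div (H.edgeProd_ne_zero w i), ← H.edge, add_sub_cancel_left]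

/-- Vieta: `x_i` and `x_i'` are the roots of the vertex relation as a quadratic in `x_i`, so `x_i
x_i' = ∑_{j ≠ i} x_j² - μ`. -/
theorem edgeRatio_mul_one_sub (H : IsBowditchWordMap μ K R x) (w : List (Fin n)) (i : Fin n) :
    edgeRatio x w i * (1 - edgeRatio x w i) =
      ∑ j ∈ Finset.univ.erase i, 1 / geo x w i j ^ 2 - μ / edgeProd x w i ^ 2 := by
  have hP := H.edgeProd_ne_zero w i
  have h1 : ∀ j ∈ Finset.univ.erase i, 1 / geo x w i j ^ 2 = x w j ^ 2 / edgeProd x w i ^ 2 := by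
    intro j hj
    have hj' := (Finset.ne_of_mem_erase hj).symm
    have := H.geo_ne_zero w hj'
    have := H.ne_zero w j
    rw [← mul_geo x w hj']
    field_simp
  rw [Finset.sum_congr rfl h1, ← Finset.sum_div, ← sub_div, H.one_sub_edgeRatio, edgeRatio,
    div_mul_div_comm, ← pow_two]
  congr 1
  have h2 := H.vertex w
  rw [← Finset.add_sum_erase _ _ (Finset.mem_univ i), ← mul_edgeProd x w i] at h2
  linear_combination x w i * H.edge w i - h2

/-- Use `(r - s)(1 - r - s) = r(1 - r) - s(1 - s)`. The terms `1 / z_j²` cancel, and only the cross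
terms of `s²` and the `μ` term survive. -/
theorem sub_mul_one_sub_sub (H : IsBowditchWordMap μ K R x) (w : List (Fin n)) (i : Fin n) :
    (edgeRatio x w i - edgeEta x w i) * (1 - edgeRatio x w i - edgeEta x w i) =
      ∑ j ∈ Finset.univ.erase i, eta (geo x w i j) *
        ∑ k ∈ (Finset.univ.erase i).erase j, eta (geo x w i k) - μ / edgeProd x w i ^ 2 := by
  have h1 := H.edgeRatio_mul_one_sub w i
  have h2 : ∑ j ∈ Finset.univ.erase i, eta (geo x w i j) *
        ∑ k ∈ (Finset.univ.erase i).erase j, eta (geo x w i k) =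
      edgeEta x w i * edgeEta x w i - edgeEta x w i +
        ∑ j ∈ Finset.univ.erase i, 1 / geo x w i j ^ 2 := by
    have : ∀ j ∈ Finset.univ.erase i, eta (geo x w i j) *
        ∑ k ∈ (Finset.univ.erase i).erase j, eta (geo x w i k) =
        eta (geo x w i j) * edgeEta x w i - eta (geo x w i j) + 1 / geo x w i j ^ 2 := by
      intro j hj
      have e := Finset.add_sum_erase (Finset.univ.erase i) (fun k => eta (geo x w i k)) hj
      rw [← eta_mul_one_sub, edgeEta, ← e]
      ring
    rw [Finset.sum_congr rfl this, Finset.sum_add_distrib, Finset.sum_sub_distrib,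
      ← Finset.sum_mul]
    rfl
  linear_combination h1 - h2

/-- All the quantities of an edge far from the root are controlled by its weight. -/
theorem exists_edge_bounds (H : IsBowditchWordMap μ K R x) :
    ∃ (a : List (Fin n) → Fin n → Fin n → ℝ) (τ C : ℝ) (L : ℕ), 0 < C ∧ IsWeight τ L a ∧
      ∀ w i, IsReduced (i :: w) → L ≤ w.length →
        1 / ‖∏ k, x (i :: w) k‖ ≤ C * edgeWeight a w i ∧
        (∀ j k, j ≠ i → k ≠ i → j ≠ k →
          ‖eta (geo x (i :: w) j k)‖ ≤ C * edgeWeight a w i) ∧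
        ‖edgeRatio x w i - edgeEta x w i‖ ≤ C * edgeWeight a w i := by
  obtain ⟨a, τ, C, κ, L, hC, hκ, ha, hL⟩ := H.exists_weight
  have hτ0 := ha.pos
  have hτ1 := ha.lt_one
  have heta : ∀ w i, IsReduced (i :: w) → L ≤ w.length → ∀ j, j ≠ i →
      ‖eta (geo x w i j)‖ ≤ C * a w i j := by
    intro w i hr hl j hj
    refine (norm_eta_le _).trans ?_
    rw [div_le_iff₀ (norm_pos_iff.2 (H.geo_ne_zero w hj.symm))]
    exact ((hL w i hr hl).2 j hj).1
  -- With this `ε` all the `η` except the dominant one sum to at most `κ / 2`.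
  obtain ⟨L', hLL', hL'⟩ := ha.exists_forall_le H.three_le (ε := κ / (2 * (C * (n + 1))))
    (by positivity)
  -- Weights are below `1`, so `1 ≤ C a |z|` bounds every `|z|` below by `1 / C`; the minimum with
  -- `1` is what `exists_pair_le_norm` asks for.
  set c := min 1 (1 / C) with hc
  have hc0 : 0 < c := lt_min one_pos (by positivity)
  set D := C * C / (c * c) with hD
  have hD0 : 0 < D := by positivity
  -- the inverse square of the edge product
  have hP : ∀ w i, IsReduced (i :: w) → L ≤ w.length →
      1 / ‖edgeProd x w i‖ ^ 2 ≤ D * edgeWeight a w i := by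
    intro w i hr hl
    obtain ⟨j, k, hj, hk, hjk, hxj, hxk⟩ := H.exists_pair_le_norm (w := w) (i := i) (c := c)
      (min_le_left _ _) (fun j hj => by
        refine (min_le_right _ _).trans ?_
        rw [div_le_iff₀ hC]
        refine (((hL w i hr hl).2 j hj).1).trans ?_
        have h2 := (ha.le hr hl hj).trans hτ1.le
        have := mul_le_mul_of_nonneg_left h2 (mul_nonneg hC.le (norm_nonneg (geo x w i j)))
        nlinarith)
    have h1 : ‖edgeProd x w i‖ ^ 2 =
        (‖x w j‖ * ‖x w k‖) * (‖geo x w i j‖ * ‖geo x w i k‖) := by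
      rw [pow_two]
      nth_rewrite 1 [← mul_geo x w hj.symm]
      rw [← mul_geo x w hk.symm, norm_mul, norm_mul]
      ring
    have hPpos : 0 < ‖edgeProd x w i‖ := norm_pos_iff.2 (H.edgeProd_ne_zero w i)
    have h2 := ha.mul_le_edgeWeight hr hl hj hk hjk
    refine le_trans ?_ (mul_le_mul_of_nonneg_left h2 hD0.le)
    rw [div_le_iff₀ (by positivity), h1]
    have hz1 := ((hL w i hr hl).2 j hj).1
    have hz2 := ((hL w i hr hl).2 k hk).1
    have h3 : 1 ≤ (C * a w i j * ‖geo x w i j‖) * (C * a w i k * ‖geo x w i k‖) :=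
      one_le_mul_of_one_le_of_one_le hz1 hz2
    have h4 : 1 ≤ ‖x w j‖ * ‖x w k‖ / (c * c) := by
      rw [one_le_div (by positivity)]
      exact mul_le_mul hxj hxk hc0.le (hc0.le.trans hxj)
    calc 1 ≤ (‖x w j‖ * ‖x w k‖ / (c * c)) *
          ((C * a w i j * ‖geo x w i j‖) * (C * a w i k * ‖geo x w i k‖)) :=
          one_le_mul_of_one_le_of_one_le h4 h3
      _ = _ := by rw [hD]; ring
  refine ⟨a, τ, 2 * D + C + (C * C + ‖μ‖ * D) * 2 / κ, L', by positivity,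
    ⟨hτ0, hτ1, fun hr hl => ha.nonneg hr (hLL'.trans hl), fun hr hl => ha.le hr (hLL'.trans hl),
      fun hr hl => ha.back hr (hLL'.trans hl), fun hr hl => ha.step hr (hLL'.trans hl)⟩,
    fun w i hr hl' => ?_⟩
  have hl : L ≤ w.length := hLL'.trans hl'
  have hE := ha.edgeWeight_nonneg hr hl
  have hPpos : 0 < ‖edgeProd x w i‖ := norm_pos_iff.2 (H.edgeProd_ne_zero w i)
  have hlast : 0 ≤ (C * C + ‖μ‖ * D) * 2 / κ := by positivity
  refine ⟨?_, ?_, ?_⟩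
  · have hg := (hL w i hr hl).1
    rw [Good] at hg
    calc 1 / ‖∏ k, x (i :: w) k‖ ≤ 1 / (1 / 2 * ‖edgeProd x w i‖ ^ 2) := by
          rw [← mul_edgeProd x _ i, H.edgeProd_cons, norm_mul]
          refine one_div_le_one_div_of_le (by positivity) ?_
          nlinarith
      _ = 2 * (1 / ‖edgeProd x w i‖ ^ 2) := by field_simp
      _ ≤ 2 * (D * edgeWeight a w i) := by gcongr; exact hP w i hr hl
      _ ≤ _ := by nlinarith [mul_nonneg hC.le hE, mul_nonneg hlast hE]
  · intro j k hj hk hjk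
    have hr' : IsReduced (j :: i :: w) := isReduced_cons.2 ⟨by simpa using hj, hr⟩
    calc ‖eta (geo x (i :: w) j k)‖ ≤ C * a (i :: w) j k :=
          heta _ _ hr' (hl.trans (Nat.le_succ _)) k hjk.symm
      _ ≤ C * edgeWeight a w i := by
          gcongr
          exact (ha.step hr hl hj hk hjk).trans (ha.mul_le_edgeWeight hr hl hj hk hjk)
      _ ≤ _ := by nlinarith [mul_nonneg hD0.le hE, mul_nonneg hlast hE]
  -- Here `1 - r = x_i' / P` is at distance at least `κ` from the dominant `η`, and the remaining
  -- terms of `s` use up at most half of that.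
  · have hsep : κ / 2 ≤ ‖1 - edgeRatio x w i - edgeEta x w i‖ := by
      obtain ⟨j₀, hj₀, hsmall⟩ := hL' w i hr hl'
      have h1 := ((hL w i hr hl).2 j₀ hj₀).2
      have hj₀' : j₀ ∈ Finset.univ.erase i := by simpa using hj₀
      have h2 : ‖∑ j ∈ (Finset.univ.erase i).erase j₀, eta (geo x w i j)‖ ≤ κ / 2 := by
        refine (norm_sum_le_of_le (f := fun j => eta (geo x w i j))
          (n := fun _ => κ / (2 * (n + 1))) _ fun j hj => ?_).trans ?_
        · simp only [Finset.mem_erase, Finset.mem_univ, and_true] at hj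
          refine (heta w i hr hl j hj.2).trans
            ((mul_le_mul_of_nonneg_left (hsmall j hj.2 hj.1) hC.le).trans (le_of_eq ?_))
          field_simp
        · have h3 : (((Finset.univ.erase i).erase j₀).card : ℝ) ≤ n + 1 := by
            have := Finset.card_le_univ ((Finset.univ.erase i).erase j₀)
            rw [Fintype.card_fin] at this
            have : (((Finset.univ.erase i).erase j₀).card : ℝ) ≤ n := by exact_mod_cast this
            linarith
          rw [Finset.sum_const, nsmul_eq_mul]
          calc _ ≤ ((n : ℝ) + 1) * (κ / (2 * (n + 1))) := by gcongr
            _ = κ / 2 := by field_simp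
      have h3 : 1 - edgeRatio x w i - edgeEta x w i =
          (x (i :: w) i / edgeProd x w i - eta (geo x w i j₀)) -
            ∑ j ∈ (Finset.univ.erase i).erase j₀, eta (geo x w i j) := by
        rw [H.one_sub_edgeRatio, edgeEta, ← Finset.add_sum_erase _ _ hj₀']
        ring
      rw [h3]
      have h4 := norm_sub_norm_le (x (i :: w) i / edgeProd x w i - eta (geo x w i j₀))
        (∑ j ∈ (Finset.univ.erase i).erase j₀, eta (geo x w i j))
      linarith
    have hrhs : ‖(edgeRatio x w i - edgeEta x w i) * (1 - edgeRatio x w i - edgeEta x w i)‖ ≤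
        (C * C + ‖μ‖ * D) * edgeWeight a w i := by
      rw [H.sub_mul_one_sub_sub, add_mul]
      refine (norm_sub_le _ _).trans (add_le_add ?_ ?_)
      · rw [edgeWeight, pairSum, Finset.mul_sum]
        refine norm_sum_le_of_le _ fun j hj => ?_
        rw [norm_mul]
        have e1 := heta w i hr hl j (Finset.ne_of_mem_erase hj)
        have e2 : ‖∑ k ∈ (Finset.univ.erase i).erase j, eta (geo x w i k)‖ ≤
            C * ∑ k ∈ (Finset.univ.erase i).erase j, a w i k := by
          rw [Finset.mul_sum]
          exact norm_sum_le_of_le _ fun k hk =>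
            heta w i hr hl k (Finset.ne_of_mem_erase (Finset.mem_of_mem_erase hk))
        refine (mul_le_mul e1 e2 (norm_nonneg _) ((norm_nonneg _).trans e1)).trans (le_of_eq ?_)
        ring
      · rw [norm_div, norm_pow, mul_assoc, div_eq_mul_one_div]
        exact mul_le_mul_of_nonneg_left (hP w i hr hl) (norm_nonneg _)
    rw [norm_mul] at hrhs
    have h5 : ‖edgeRatio x w i - edgeEta x w i‖ ≤
        (C * C + ‖μ‖ * D) * 2 / κ * edgeWeight a w i := by
      rw [div_mul_eq_mul_div, le_div_iff₀ hκ]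
      nlinarith [mul_le_mul_of_nonneg_left hsep (norm_nonneg (edgeRatio x w i - edgeEta x w i))]
    nlinarith [mul_nonneg hC.le hE, mul_nonneg hD0.le hE]

end IsBowditchWordMap

/-! ### Summation over the levels of the tree -/

/-- The sum over the edges between the levels `m` and `m + 1`. -/
def edgeSum {n : ℕ} (f : List (Fin n) → Fin n → ℂ) (m : ℕ) : ℂ :=
  ∑ w ∈ level n m, ∑ i ∈ freeColours w, f w i

/-- The sum over the geodesics with gate `w`, both of whose ends are counted. -/
def gateSum {n : ℕ} (x : List (Fin n) → Fin n → ℂ) (w : List (Fin n)) : ℂ :=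
  ∑ i ∈ freeColours w, ∑ j ∈ (freeColours w).erase i, eta (geo x w i j)

theorem sum_sum_erase_pair {ι M : Type*} [DecidableEq ι] [AddCommMonoid M] (s : Finset ι)
    (F : Finset ι → M) :
    ∑ i ∈ s, ∑ j ∈ s.erase i, F {i, j} = ∑ I ∈ Finset.powersetCard 2 s, 2 • F I := by
  have h1 : ∀ I ∈ Finset.powersetCard 2 s, 2 • F I = ∑ i ∈ I, F I := fun I hI => by
    rw [Finset.sum_const, (Finset.mem_powersetCard.1 hI).2]
  rw [Finset.sum_congr rfl h1, Finset.sum_comm' (t' := s)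
    (s' := fun i => (Finset.powersetCard 2 s).filter fun I => i ∈ I)]
  · refine Finset.sum_congr rfl fun i hi => ?_
    refine Finset.sum_bij (fun j _ => {i, j}) ?_ ?_ ?_ fun _ _ => rfl
    · intro j hj
      obtain ⟨hji, hj⟩ := Finset.mem_erase.1 hj
      simp only [Finset.mem_filter, Finset.mem_powersetCard, Finset.insert_subset_iff,
        Finset.singleton_subset_iff]
      exact ⟨⟨⟨hi, hj⟩, Finset.card_pair hji.symm⟩, by simp⟩
    · intro j hj k hk h
      have h2 : j ∈ ({i, k} : Finset ι) := h ▸ (by simp : j ∈ ({i, j} : Finset ι))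
      simpa [Finset.ne_of_mem_erase hj] using h2
    · intro I hI
      obtain ⟨hI, hiI⟩ := Finset.mem_filter.1 hI
      obtain ⟨hIs, hc⟩ := Finset.mem_powersetCard.1 hI
      obtain ⟨j, hj⟩ := Finset.card_eq_one.1
        (show (I.erase i).card = 1 by rw [Finset.card_erase_of_mem hiI, hc])
      have hjm : j ∈ I.erase i := by simp [hj]
      refine ⟨j, Finset.mem_erase.2 ⟨Finset.ne_of_mem_erase hjm,
        hIs (Finset.mem_of_mem_erase hjm)⟩, ?_⟩
      rw [← Finset.insert_erase hiI, hj]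
  · intro I i
    simp only [Finset.mem_filter, Finset.mem_powersetCard]
    constructor
    · rintro ⟨h, hi⟩
      exact ⟨⟨h, hi⟩, h.1 hi⟩
    · rintro ⟨h, -⟩
      exact h

/-- Each pair of colours occurs in both orders, once per end of the geodesic, and `2 η = h`. -/
theorem gateSum_eq {n : ℕ} (x : List (Fin n) → Fin n → ℂ) (w : List (Fin n)) :
    gateSum x w = ∑ I ∈ Finset.powersetCard 2 (freeColours w), h (∏ k ∈ Iᶜ, x w k) := by
  rw [gateSum]
  refine (sum_sum_erase_pair (freeColours w) fun I => eta (∏ k ∈ Iᶜ, x w k)).trans ?_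
  refine Finset.sum_congr rfl fun I _ => ?_
  rw [eta, nsmul_eq_mul]
  push_cast
  ring

namespace IsBowditchWordMap

variable {n : ℕ} {μ : ℂ} {K : ℝ} {R : ℕ} {x : List (Fin n) → Fin n → ℂ}

theorem sum_edgeRatio (H : IsBowditchWordMap μ K R x) (w : List (Fin n)) :
    ∑ i, edgeRatio x w i = 1 + μ / ∏ k, x w k := by
  have hp : ∏ k, x w k ≠ 0 := Finset.prod_ne_zero_iff.2 fun k _ => H.ne_zero w k
  have h1 : ∀ i, edgeRatio x w i = x w i ^ 2 / ∏ k, x w k := by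
    intro i
    rw [edgeRatio, ← mul_edgeProd x w i, pow_two, mul_div_mul_left _ _ (H.ne_zero w i)]
  rw [Finset.sum_congr rfl fun i _ => h1 i, ← Finset.sum_div, ← H.vertex w]
  field_simp
  ring

/-- Conservation at a vertex: the edge back to the root has ratio `1 - r`, so the outgoing ratios
sum to the incoming `r` plus `μ / φ(v)`. -/
theorem sum_edgeRatio_cons (H : IsBowditchWordMap μ K R x) (l : Fin n) (w : List (Fin n)) :
    ∑ i ∈ freeColours (l :: w), edgeRatio x (l :: w) i =
      edgeRatio x w l + μ / ∏ k, x (l :: w) k := by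
  have h1 := H.sum_edgeRatio (l :: w)
  have h2 : edgeRatio x (l :: w) l = 1 - edgeRatio x w l := by
    rw [H.one_sub_edgeRatio, edgeRatio, H.edgeProd_cons]
  rw [← Finset.add_sum_erase _ _ (Finset.mem_univ l), h2] at h1
  rw [freeColours_cons]
  linear_combination h1

/-- Geodesics using the colour `l` continue from the incoming edge; the others have their gate at `l
:: w` and start with both ends there. -/
theorem sum_edgeEta_cons (H : IsBowditchWordMap μ K R x) (l : Fin n) (w : List (Fin n)) :
    ∑ i ∈ freeColours (l :: w), edgeEta x (l :: w) i = edgeEta x w l + gateSum x (l :: w) := by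
  rw [gateSum, freeColours_cons, edgeEta, ← Finset.sum_add_distrib]
  refine Finset.sum_congr rfl fun i hi => ?_
  have hil := Finset.ne_of_mem_erase hi
  rw [edgeEta, ← Finset.add_sum_erase _ _
    (show l ∈ Finset.univ.erase i by simpa using hil.symm), geo_comm, H.geo_cons,
    Finset.erase_right_comm]

theorem edgeSum_edgeRatio (H : IsBowditchWordMap μ K R x) (m : ℕ) :
    edgeSum (edgeRatio x) m =
      1 + ∑ t ∈ Finset.range (m + 1), ∑ w ∈ level n t, μ / ∏ k, x w k := by
  induction m with
  | zero => simp [edgeSum, level, H.sum_edgeRatio]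
  | succ m ih =>
    rw [Finset.sum_range_succ, ← add_assoc, ← ih, edgeSum, edgeSum,
      sum_level_succ (fun w => ∑ i ∈ freeColours w, edgeRatio x w i),
      sum_level_succ (fun w => μ / ∏ k, x w k), ← Finset.sum_add_distrib]
    refine Finset.sum_congr rfl fun w _ => ?_
    rw [← Finset.sum_add_distrib]
    exact Finset.sum_congr rfl fun i _ => H.sum_edgeRatio_cons i w

theorem edgeSum_edgeEta (H : IsBowditchWordMap μ K R x) (m : ℕ) :
    edgeSum (edgeEta x) m = ∑ t ∈ Finset.range (m + 1), ∑ w ∈ level n t, gateSum x w := by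
  induction m with
  | zero => simp [edgeSum, level, gateSum, edgeEta]
  | succ m ih =>
    rw [Finset.sum_range_succ, ← ih, edgeSum, edgeSum,
      sum_level_succ (fun w => ∑ i ∈ freeColours w, edgeEta x w i),
      sum_level_succ (gateSum x), ← Finset.sum_add_distrib]
    refine Finset.sum_congr rfl fun w _ => ?_
    rw [← Finset.sum_add_distrib]
    exact Finset.sum_congr rfl fun i _ => H.sum_edgeEta_cons i w

end IsBowditchWordMap

theorem summable_of_level_sum_le {n : ℕ} {f : List (Fin n) → ℝ} (hf : ∀ w, 0 ≤ f w) {C ρ : ℝ}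
    (hρ0 : 0 ≤ ρ) (hρ1 : ρ < 1) {L : ℕ} (h : ∀ t, ∑ w ∈ level n (L + t), f w ≤ C * ρ ^ t) :
    Summable fun p : (Σ m : ℕ, {w // w ∈ level n m}) => f p.2.1 := by
  rw [summable_sigma_of_nonneg fun p => hf _]
  refine ⟨fun m => Summable.of_finite, ?_⟩
  have h1 : ∀ m, ∑' w : {w // w ∈ level n m}, f w.1 = ∑ w ∈ level n m, f w := fun m => by
    rw [tsum_fintype]
    exact Finset.sum_coe_sort (level n m) f
  simp only [h1]
  rw [← summable_nat_add_iff L]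
  refine Summable.of_nonneg_of_le (fun t => Finset.sum_nonneg fun w _ => hf w) (fun t => ?_)
    ((summable_geometric_of_lt_one hρ0 hρ1).mul_left C)
  rw [add_comm]
  exact h t

theorem tendsto_level_sum {n : ℕ} {F : List (Fin n) → ℂ}
    (hF : Summable fun p : (Σ m : ℕ, {w // w ∈ level n m}) => F p.2.1) :
    Tendsto (fun m => ∑ t ∈ Finset.range m, ∑ w ∈ level n t, F w) atTop
      (𝓝 (∑' p : (Σ m : ℕ, {w // w ∈ level n m}), F p.2.1)) := by
  refine HasSum.tendsto_sum_nat (hF.hasSum.sigma fun m => ?_)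
  rw [← Finset.sum_coe_sort (level n m) F]
  exact hasSum_fintype _

namespace IsBowditchWordMap

variable {n : ℕ} {μ : ℂ} {K : ℝ} {R : ℕ} {x : List (Fin n) → Fin n → ℂ}

theorem sum_norm_h_le {C E : ℝ} {i : Fin n} {w : List (Fin n)}
    (hE : ∀ j k, j ≠ i → k ≠ i → j ≠ k → ‖eta (geo x (i :: w) j k)‖ ≤ C * E) :
    ∑ I ∈ Finset.powersetCard 2 (freeColours (i :: w)), ‖h (∏ k ∈ Iᶜ, x (i :: w) k)‖ ≤
      (Finset.powersetCard 2 (Finset.univ.erase i)).card * (2 * (C * E)) := by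
  rw [freeColours_cons, ← nsmul_eq_mul]
  refine Finset.sum_le_card_nsmul _ _ _ fun I hI => ?_
  obtain ⟨hs, hc⟩ := Finset.mem_powersetCard.1 hI
  obtain ⟨j, k, hjk, rfl⟩ := Finset.card_eq_two.1 hc
  have h1 := hE j k (Finset.ne_of_mem_erase (hs (by simp)))
    (Finset.ne_of_mem_erase (hs (by simp))) hjk
  rw [eta, norm_div, Complex.norm_ofNat, geo] at h1
  linarith

theorem identity (H : IsBowditchWordMap μ K R x) :
    (Summable fun p : (Σ m : ℕ, {w // w ∈ level n m}) =>
      ∑ I ∈ Finset.powersetCard 2 (freeColours p.2.1), ‖h (∏ k ∈ Iᶜ, x p.2.1 k)‖) ∧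
    (Summable fun p : (Σ m : ℕ, {w // w ∈ level n m}) => ‖μ / ∏ k, x p.2.1 k‖) ∧
    (∑' p : (Σ m : ℕ, {w // w ∈ level n m}), gateSum x p.2.1) -
      (∑' p : (Σ m : ℕ, {w // w ∈ level n m}), μ / ∏ k, x p.2.1 k) = 1 := by
  obtain ⟨a, τ, C, L₀, hC, ha, hb₀⟩ := H.exists_edge_bounds
  obtain ⟨ρ, hρ0, hρ1, B, L, hL, hsum⟩ := ha.exists_level_sum_le H.three_le
  have hb := fun w i hr (hl : L ≤ w.length) => hb₀ w i hr (hL.trans hl)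
  have hlevel : ∀ {f : List (Fin n) → ℝ} {D : ℝ}, 0 ≤ D → (∀ w i, IsReduced (i :: w) →
      L ≤ w.length → f (i :: w) ≤ D * edgeWeight a w i) →
      ∀ t, ∑ w ∈ level n (L + 1 + t), f w ≤ (D * B) * ρ ^ t := by
    intro f D hD hf t
    -- Each vertex on level `L + 1 + t` is charged to the edge entering it, which leaves level `L +
    -- t`.
    rw [show L + 1 + t = L + t + 1 by ring, sum_level_succ, mul_assoc]
    refine le_trans ?_ (mul_le_mul_of_nonneg_left (hsum t) hD)
    rw [Finset.mul_sum]
    refine Finset.sum_le_sum fun w hw => ?_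
    rw [Finset.mul_sum]
    refine Finset.sum_le_sum fun i hi => ?_
    obtain ⟨hr, hl⟩ := mem_level.1 hw
    exact hf w i (isReduced_cons.2 ⟨hi, hr⟩) (by omega)
  have s1 : Summable fun p : (Σ m : ℕ, {w // w ∈ level n m}) =>
      ∑ I ∈ Finset.powersetCard 2 (freeColours p.2.1), ‖h (∏ k ∈ Iᶜ, x p.2.1 k)‖ := by
    refine summable_of_level_sum_le
      (f := fun w => ∑ I ∈ Finset.powersetCard 2 (freeColours w), ‖h (∏ k ∈ Iᶜ, x w k)‖)
      (fun w => Finset.sum_nonneg fun _ _ => norm_nonneg _) hρ0.le hρ1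
      (hlevel (D := Fintype.card (Finset (Fin n)) * (2 * C)) (by positivity) ?_)
    intro w i hr hl
    have hE := ha.edgeWeight_nonneg hr (hL.trans hl)
    refine (sum_norm_h_le (hb w i hr hl).2.1).trans ?_
    have h1 : ((Finset.powersetCard 2 (Finset.univ.erase i)).card : ℝ) ≤
        Fintype.card (Finset (Fin n)) := by
      exact_mod_cast Finset.card_le_univ _
    calc _ ≤ (Fintype.card (Finset (Fin n)) : ℝ) * (2 * (C * edgeWeight a w i)) := by gcongr
      _ = _ := by ring
  have s2 : Summable fun p : (Σ m : ℕ, {w // w ∈ level n m}) => ‖μ / ∏ k, x p.2.1 k‖ := by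
    refine summable_of_level_sum_le (f := fun w => ‖μ / ∏ k, x w k‖)
      (fun w => norm_nonneg _) hρ0.le hρ1
      (hlevel (D := ‖μ‖ * C) (by positivity) ?_)
    intro w i hr hl
    rw [norm_div, div_eq_mul_one_div, mul_assoc]
    exact mul_le_mul_of_nonneg_left (hb w i hr hl).1 (norm_nonneg _)
  refine ⟨s1, s2, ?_⟩
  have s3 : Summable fun p : (Σ m : ℕ, {w // w ∈ level n m}) => gateSum x p.2.1 := by
    refine Summable.of_norm_bounded s1 fun p => ?_
    rw [gateSum_eq]
    exact norm_sum_le _ _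
  have t1 := (tendsto_level_sum s3).comp (tendsto_add_atTop_nat 1)
  have t2 := (tendsto_level_sum (F := fun w => μ / ∏ k, x w k) s2.of_norm).comp
    (tendsto_add_atTop_nat 1)
  have t3 : Tendsto (fun m => edgeSum (edgeRatio x) m - edgeSum (edgeEta x) m) atTop (𝓝 0) := by
    rw [← tendsto_add_atTop_iff_nat L]
    refine squeeze_zero_norm (a := fun t => C * B * ρ ^ t) (fun t => ?_) ?_
    · rw [edgeSum, edgeSum, ← Finset.sum_sub_distrib, mul_assoc, add_comm]
      refine le_trans ?_ (mul_le_mul_of_nonneg_left (hsum t) hC.le)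
      rw [Finset.mul_sum]
      refine norm_sum_le_of_le _ fun w hw => ?_
      rw [← Finset.sum_sub_distrib, Finset.mul_sum]
      refine norm_sum_le_of_le _ fun i hi => ?_
      obtain ⟨hr, hl⟩ := mem_level.1 hw
      exact (hb w i (isReduced_cons.2 ⟨hi, hr⟩) (by omega)).2.2
    · simpa using (tendsto_pow_atTop_nhds_zero_of_lt_one hρ0.le hρ1).const_mul (C * B)
  simp only [H.edgeSum_edgeRatio, H.edgeSum_edgeEta] at t3
  have t4 := tendsto_nhds_unique t3 ((t2.const_add 1).sub t1)
  linear_combination t4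

end IsBowditchWordMap

/-! ### The word map of a Hurwitz map -/

/-- A Hurwitz map read on words. -/
def wordMap {n : ℕ} (φ : X n → ℂ) (w : List (Fin n)) (i : Fin n) : ℂ :=
  φ (hatSubtree (evalWord w) i)

theorem extend_regSubtree_evalWord {n k : ℕ} (φ : X n → ℂ) (w : List (Fin n))
    (I : Finset (Fin n)) (hI : I.card = k) :
    extend φ (regSubtree (evalWord w) I hI) = ∏ j ∈ Iᶜ, wordMap φ w j :=
  rfl

theorem vertexValue_evalWord {n : ℕ} (φ : X n → ℂ) (w : List (Fin n)) :
    vertexValue φ (evalWord w) = ∏ j, wordMap φ w j := by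
  rw [vertexValue, extend_regSubtree_evalWord, Finset.compl_empty]

theorem exists_isBowditchWordMap {n : ℕ} (hn : 3 ≤ n) {μ : ℂ} {φ : X n → ℂ}
    (hφ : φ ∈ bowditchSetMu n μ) : ∃ K R, IsBowditchWordMap μ K R (wordMap φ) := by
  obtain ⟨⟨-, hA, K, hK, hfin⟩, hH, hv⟩ := hφ
  -- Finitely many small geodesics have gates of bounded depth `B`, so `R = B + 1` works.
  obtain ⟨B, hB⟩ := (hfin.image fun γ => ((geodesicEquiv n).symm γ).1.1).bddAbove
  refine ⟨K, B + 1, hn, hK, ?_, fun w i => hH (evalWord w) i, fun w => hv (evalWord w), ?_, ?_⟩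
  · intro w i j hij
    exact congrArg φ (hatSubtree_mul_gen (evalWord w) hij.symm)
  · intro w i j hij
    exact hA (regSubtree (evalWord w) {i, j} (Finset.card_pair hij))
  · intro w hw hl i j hi hj hij
    by_contra! hle
    have hI : ({i, j} : Finset (Fin n)) ∈ Finset.powersetCard 2 (freeColours w) :=
      Finset.mem_powersetCard.2 ⟨by simp [Finset.insert_subset_iff, hi, hj], Finset.card_pair hij⟩
    let q : Σ p : (Σ m : ℕ, {w // w ∈ level n m}),
        {I // I ∈ Finset.powersetCard 2 (freeColours p.2.1)} :=
      ⟨⟨w.length, w, mem_level.2 ⟨hw, rfl⟩⟩, {i, j}, hI⟩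
    have h1 : geodesicEquiv n q ∈ smallGeodesics φ K := hle
    have h2 := hB ⟨_, h1, rfl⟩
    simp only [Equiv.symm_apply_apply] at h2
    change w.length ≤ B at h2
    omega

/-- The identity of McShane type for Hurwitz maps in `ℬ_μ`. -/
theorem mcShane_identity (n : ℕ) (hn : 3 ≤ n) (μ : ℂ) (φ : X n → ℂ)
    (hφ : φ ∈ bowditchSetMu n μ) :
    (Summable fun γ : A n => ‖h (extend φ γ)‖) ∧
    (Summable fun v : Gamma n => ‖μ / vertexValue φ v‖) ∧
    (∑' γ : A n, h (extend φ γ)) -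
        (∑' v : Gamma n, μ / vertexValue φ v) = 1 ∧
    (μ = 0 →
      (∑' γ : A n,
        (1 - Complex.sqrt (1 - 4 / extend φ γ ^ 2))) = 1) := by
  obtain ⟨K, R, H⟩ := exists_isBowditchWordMap hn hφ
  obtain ⟨s1, s2, hid⟩ := H.identity
  have hsumA : Summable fun γ : A n =>
      ‖h (extend φ γ)‖ := by
    rw [← (geodesicEquiv n).summable_iff]
    refine (summable_sigma_of_nonneg fun _ => norm_nonneg _).2 ⟨fun p => Summable.of_finite,
      s1.congr fun p => ?_⟩
    rw [tsum_fintype]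
    exact (Finset.sum_coe_sort (Finset.powersetCard 2 (freeColours p.2.1))
      fun I => ‖h (∏ k ∈ Iᶜ, wordMap φ p.2.1 k)‖).symm
  have hval : ∀ p, vertexValue φ (vertexEquiv n p) = ∏ k, wordMap φ p.2.1 k := fun p =>
    vertexValue_evalWord φ p.2.1
  have htA : ∑' γ : A n, h (extend φ γ) =
      ∑' p : (Σ m : ℕ, {w // w ∈ level n m}), gateSum (wordMap φ) p.2.1 := by
    rw [← (geodesicEquiv n).tsum_eq, Summable.tsum_sigma]
    · refine tsum_congr fun p => ?_
      rw [tsum_fintype, gateSum_eq]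
      exact Finset.sum_coe_sort (Finset.powersetCard 2 (freeColours p.2.1))
        fun I => h (∏ k ∈ Iᶜ, wordMap φ p.2.1 k)
    · exact (geodesicEquiv n).summable_iff.2 hsumA.of_norm
  have htV : ∑' v : Gamma n, μ / vertexValue φ v =
      ∑' p : (Σ m : ℕ, {w // w ∈ level n m}), μ / ∏ k, wordMap φ p.2.1 k := by
    rw [← (vertexEquiv n).tsum_eq]
    simp only [hval]
  have hmain := hid
  rw [← htA, ← htV] at hmain
  refine ⟨hsumA, ?_, hmain, fun hμ => ?_⟩
  · rw [← (vertexEquiv n).summable_iff]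
    refine s2.congr fun p => ?_
    rw [Function.comp_apply, hval]
  · subst hμ
    simpa [h] using hmain

end

end MarkoffHurwitz

theorem theorem4p3 (n : ℕ) (hn : 3 ≤ n) (μ : ℂ) (φ : MarkoffHurwitz.X n → ℂ)
    (hφ : φ ∈ MarkoffHurwitz.bowditchSetMu n μ) :
    (Summable fun γ : MarkoffHurwitz.A n => ‖MarkoffHurwitz.h (MarkoffHurwitz.extend φ γ)‖) ∧
    (Summable fun v : MarkoffHurwitz.Gamma n => ‖μ / MarkoffHurwitz.vertexValue φ v‖) ∧
    (∑' γ : MarkoffHurwitz.A n, MarkoffHurwitz.h (MarkoffHurwitz.extend φ γ)) -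
        (∑' v : MarkoffHurwitz.Gamma n, μ / MarkoffHurwitz.vertexValue φ v) = 1 ∧
    (μ = 0 →
      (∑' γ : MarkoffHurwitz.A n,
        (1 - Complex.sqrt (1 - 4 / MarkoffHurwitz.extend φ γ ^ 2))) = 1) :=
  MarkoffHurwitz.mcShane_identity n hn μ φ hφ
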